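/- Let $\mathcal S=\{x_1+x_2 n:\ x_1,x_2\in\mathbb R\}$, $n^2=0$, be the algebra of dual numbers, $\mathcal S_c=\{z_1+z_2n:\ z_1,z_2\in\mathbb C\}$ its complexification, with conjugation $\overline{X+iY}=X-iY$ and imaginary part $\mathrm{Im}(X+iY)=Y$ for $X,Y\in\mathcal S$. Write $Z=z_1+z_2n$, $W=w_1+w_2n$ and let $$\mathcal Q=\{(Z,W)\in\mathcal S_c^2:\ \mathrm{Im}\,W=Z^2\bar Z^2\},$$ i.e. the surface $\mathrm{Im}\,w_1=|z_1|^4,\ \mathrm{Im}\,w_2=4\,\mathrm{Re}(z_1^2\bar z_1\bar z_2)$ in $\mathbb C^4$. Let $\mathrm{aut}\,\mathcal Q$ be the real vector space of germs at $0$ of vector fields $2\,\mathrm{Re}\,(f\,\partial/\partial Z+g\,\partial/\partial W)$, with $f,g$ holomorphic near $0$ in $\mathbb C^4$, that are tangent to $\mathcal Q$ near $0$, and let $\mathrm{aut}_{\mathcal S}\,\mathcal Q$ be the subspace of those for which $f,g$ are $\mathcal S$-holomorphic, i.e. sums near $0$ of convergent power series in $Z,W$ with coefficients in $\mathcal S_c$.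 Let $\mathrm{Aut}\,\mathcal Q=\exp(\mathrm{aut}\,\mathcal Q)$ be the local group of germs at $0$ of the time-one maps of these fields (where the flow exists near $0$ up to time one), and $\mathrm{Aut}_{\mathcal S}\,\mathcal Q$ the set of its $\mathcal S$-holomorphic elements. 1. $\mathrm{aut}\,\mathcal Q$ is finite-dimensional, $\dim_{\mathbb R}\mathrm{aut}\,\mathcal Q=\dim_{\mathbb R}\mathrm{aut}_{\mathcal S}\,\mathcal Q+1$, and $$\mathrm{aut}\,\mathcal Q=\mathrm{aut}_{\mathcal S}\,\mathcal Q\ \oplus\ \mathbb R\cdot 2\,\mathrm{Re}\Big(z_2\frac{\partial}{\partial z_2}+w_2\frac{\partial}{\partial w_2}\Big).$$ 2. The field $2\,\mathrm{Re}(z_2\,\partial/\partial z_2+w_2\,\partial/\partial w_2)$ generates the one-parameter group of holomorphic automorphisms of $\mathcal Q$ $$z_1\to z_1,\quad z_2\to e^tz_2,\quad w_1\to w_1,\quad w_2\to e^{t}w_2 .$$ 3. $\mathrm{Aut}_{\mathcal S}\,\mathcal Q=\exp(\mathrm{aut}_{\mathcal S}\,\mathcal Q)$. It contains the germs at $0$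 of all the maps $$G_{-4}:\ Z\to Z,\ W\to W+A\quad(A\in\mathcal S),$$ $$G_0:\ Z\to BZ,\ W\to B^2\bar B^2\,W\quad(B\in\mathcal S_c\ \text{invertible}),$$ $$G_4:\ Z\to Z\,(1-CW)^{-1/2},\ W\to W\,(1-CW)^{-1}\quad(C\in\mathcal S),$$ where $(1-CW)^{-1/2}$ is the sum of the binomial series, and an element of $\mathrm{Aut}\,\mathcal Q$ belongs to $\mathrm{Aut}_{\mathcal S}\,\mathcal Q$ if and only if it is the germ at $0$ of a composition of one map $G_4$, one map $G_0$ and one map $G_{-4}$ (applied in this order). -/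

import Mathlib

open Filter Topology

noncomputable section

namespace AlgCR

section General

variable {E F : Type*} [NormedAddCommGroup E] [NormedSpace ℂ E] [NormedSpace ℝ E]
  [NormedAddCommGroup F] [NormedSpace ℝ F]

/-- Infinitesimal holomorphic automorphisms of the real submanifold `{ρ = 0}` near the origin:
germs at `0` of real vector fields `2 Re (∑ fⱼ ∂/∂zⱼ)` with `f` holomorphic near `0`, tangent to
`{ρ = 0}`. The real field `2 Re (∑ fⱼ ∂/∂zⱼ)` acts on a real-differentiable function `u` at `p` by
the real derivative of `u` at `p` in the direction `f p`, so it is identified with the germ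
of `f`. -/
def aut (ρ : E → F) [IsScalarTower ℝ ℂ E] : Submodule ℝ (Germ (𝓝 (0 : E)) E) where
  carrier := {X | ∃ f : E → E, X = (f : Germ (𝓝 (0 : E)) E) ∧ AnalyticAt ℂ f 0 ∧
    ∀ᶠ p in 𝓝 (0 : E), ρ p = 0 → fderiv ℝ ρ p (f p) = 0}
  add_mem' := by
    rintro _ _ ⟨f, rfl, hf, hf'⟩ ⟨g, rfl, hg, hg'⟩
    refine ⟨f + g, rfl, hf.add hg, ?_⟩
    filter_upwards [hf', hg'] with p h1 h2 hp
    simp [h1 hp, h2 hp]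
  zero_mem' := by
    refine ⟨0, rfl, analyticAt_const, ?_⟩
    filter_upwards with p _
    simp
  smul_mem' := by
    rintro c _ ⟨f, rfl, hf, hf'⟩
    refine ⟨c • f, rfl, ?_, ?_⟩
    · have h : c • f = (c : ℂ) • f := by
        funext p
        simp only [Pi.smul_apply]
        rw [← one_smul ℂ (f p), ← smul_assoc, ← smul_assoc]
        simp
      rw [h]
      exact hf.const_smul
    · filter_upwards [hf'] with p h1 hp
      simp [h1 hp]

/-- `H` is the germ at `0` of the time-one map `exp X` of the flow of the holomorphic vector field
with germ `X`: for every `p` near `0` the integral curve of the field starting at `p` exists for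
`0 ≤ t ≤ 1` (inside a connected neighbourhood of `0` on which the field is holomorphic) and ends
at `H p`. -/
def IsExp (X H : Germ (𝓝 (0 : E)) E) : Prop :=
  ∃ (U : Set E) (f h : E → E), IsOpen U ∧ IsConnected U ∧ (0 : E) ∈ U ∧ AnalyticOnNhd ℂ f U ∧
    X = (f : Germ (𝓝 (0 : E)) E) ∧ H = (h : Germ (𝓝 (0 : E)) E) ∧
    ∀ᶠ p in 𝓝 (0 : E), ∃ γ : ℝ → E, γ 0 = p ∧ γ 1 = h p ∧
      ∀ t ∈ Set.Icc (0 : ℝ) 1,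
        γ t ∈ U ∧ HasDerivWithinAt γ (f (γ t)) (Set.Icc (0 : ℝ) 1) t

/-- The local group `exp (aut {ρ = 0})`, as a set of germs of maps at `0`. -/
def AutLoc (ρ : E → F) [IsScalarTower ℝ ℂ E] : Set (Germ (𝓝 (0 : E)) E) :=
  {H | ∃ X ∈ aut ρ, IsExp X H}

end General

/-- The algebra `S` of dual numbers `x₁ + x₂ n`, `n² = 0`, over the reals. -/
abbrev S := DualNumber ℝ

/-- The complexification of `S`, with elements `z₁ + z₂ n`; `z₁ = Z.fst`, `z₂ = Z.snd`. -/
abbrev Sc := DualNumber ℂ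

/-- The element `z₁ + z₂ n`. -/
def mkSc (z₁ z₂ : ℂ) : Sc := TrivSqZeroExt.inl z₁ + TrivSqZeroExt.inr z₂

/-- The inclusion of `S` in `Sc`. -/
def ofS (X : S) : Sc := mkSc X.fst X.snd

/-- The conjugation `X + iY ↦ X - iY` of `Sc`, where `X, Y` are in `S`. -/
def conjS (Z : Sc) : Sc := mkSc (star Z.fst) (star Z.snd)

/-- The imaginary part `Y` of `X + iY`, where `X, Y` are in `S`. -/
def imS (Z : Sc) : S := TrivSqZeroExt.inl Z.fst.im + TrivSqZeroExt.inr Z.snd.im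

/-- The defining function `Im W - Z² Z̄²`. -/
def rho (p : Sc × Sc) : Sc := ofS (imS p.2) - p.1 ^ 2 * conjS p.1 ^ 2

/-- The surface `Im W = Z² Z̄²`. -/
def Q : Set (Sc × Sc) := {p | rho p = 0}

/-- `u` is the sum near `0` of a power series in `Z, W` with coefficients in `Sc`. -/
def SHolFun (u : Sc × Sc → Sc) : Prop :=
  ∃ c : ℕ × ℕ → Sc, ∀ᶠ p in 𝓝 (0 : Sc × Sc),
    HasSum (fun j : ℕ × ℕ => c j * p.1 ^ j.1 * p.2 ^ j.2) (u p)

/-- Germs of `S`-holomorphic mappings of `Sc × Sc` to itself. -/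
def SHol (X : Germ (𝓝 (0 : Sc × Sc)) (Sc × Sc)) : Prop :=
  ∃ f : Sc × Sc → Sc × Sc, X = (f : Germ (𝓝 (0 : Sc × Sc)) (Sc × Sc)) ∧
    SHolFun (fun p => (f p).1) ∧ SHolFun (fun p => (f p).2)

lemma SHolFun.add {u v : Sc × Sc → Sc} (hu : SHolFun u) (hv : SHolFun v) :
    SHolFun (fun p => u p + v p) := by
  obtain ⟨c, hc⟩ := hu
  obtain ⟨d, hd⟩ := hv
  refine ⟨fun j => c j + d j, ?_⟩
  filter_upwards [hc, hd] with p h1 h2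
  simpa [add_mul] using h1.add h2

lemma SHolFun.smul {u : Sc × Sc → Sc} (r : ℝ) (hu : SHolFun u) :
    SHolFun (fun p => r • u p) := by
  obtain ⟨c, hc⟩ := hu
  refine ⟨fun j => r • c j, ?_⟩
  filter_upwards [hc] with p h1
  simpa [smul_mul_assoc] using h1.const_smul r

/-- The `S`-holomorphic fields in `aut Q`. -/
def autS : Submodule ℝ (Germ (𝓝 (0 : Sc × Sc)) (Sc × Sc)) where
  carrier := {X | X ∈ aut rho ∧ SHol X}
  add_mem' := by
    rintro _ _ ⟨h1, f, rfl, hf, hf'⟩ ⟨h2, g, rfl, hg, hg'⟩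
    exact ⟨add_mem h1 h2, f + g, rfl, hf.add hg, hf'.add hg'⟩
  zero_mem' := by
    refine ⟨zero_mem _, 0, rfl, ⟨0, ?_⟩, ⟨0, ?_⟩⟩ <;>
    · filter_upwards with p
      simp
  smul_mem' := by
    rintro r _ ⟨h1, f, rfl, hf, hf'⟩
    exact ⟨(aut rho).smul_mem r h1, r • f, rfl, hf.smul r, hf'.smul r⟩

/-- The `S`-holomorphic elements of the local group of `Q`. -/
def AutSLoc : Set (Germ (𝓝 (0 : Sc × Sc)) (Sc × Sc)) := {H | H ∈ AutLoc rho ∧ SHol H}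

/-- The field `2 Re (z₂ ∂/∂z₂ + w₂ ∂/∂w₂)`. -/
def X0 (p : Sc × Sc) : Sc × Sc := (mkSc 0 p.1.snd, mkSc 0 p.2.snd)

/-- The map `z₁ ↦ z₁, z₂ ↦ eᵗ z₂, w₁ ↦ w₁, w₂ ↦ eᵗ w₂`. -/
def flow (t : ℝ) (p : Sc × Sc) : Sc × Sc :=
  (mkSc p.1.fst (Complex.exp t * p.1.snd), mkSc p.2.fst (Complex.exp t * p.2.snd))

/-- `Z ↦ Z, W ↦ W + A`. -/
def GNeg (A : S) (p : Sc × Sc) : Sc × Sc := (p.1, p.2 + ofS A)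

/-- `Z ↦ B Z, W ↦ B² B̄² W`. -/
def GZero (B : Sc) (p : Sc × Sc) : Sc × Sc := (B * p.1, B ^ 2 * conjS B ^ 2 * p.2)

/-- `Z ↦ Z (1 - C W)^(-1/2), W ↦ W (1 - C W)⁻¹`, the power `-1/2` being the sum of the
binomial series. -/
def GPos (C : S) (p : Sc × Sc) : Sc × Sc :=
  (p.1 * (binomialSeries Sc (-1 / 2 : ℂ)).sum (-(ofS C * p.2)), p.2 * (1 - ofS C * p.2)⁻¹)

/-- The germ at `0` of a map. -/
def germ (h : Sc × Sc → Sc × Sc) : Germ (𝓝 (0 : Sc × Sc)) (Sc × Sc) := h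

end AlgCR

end

/-!
On the complexified surface `w - ω = 2 i z² ζ²`, where `ζ, ω` replace `Z̄, W̄`, tangency of `(f, g)`
reads `g(w) - ḡ(ω) = 4 i (z ζ² f(z, w) + z² ζ f̄(ζ, ω))`, and `ζ = 0` shows that `g` depends on `w`
only and `g = ḡ`. The terms of second order at `ζ = 0` make `z f(z, w)` a complex-linear function
of `z²`. As `n` is nilpotent, this linearity is over `ℂ` only, and division by `z` leaves
`f = z a(w) + z₂ q(w) n`. Moving `(z, ζ)` to `(z (1 + τ n), ζ (1 - τ n))`, which preserves `z² ζ²`,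
shows that `q` is a real constant: this is the additional field. What remains is the functional
equation `g(w) - g(ω) = 2 (w - ω) (a(w) + ā(ω))`, whose solutions are quadratic polynomials `g`
and affine functions `a`.

For the local group, the flow of the additional field is split off, which turns the rest into an
`S`-holomorphic field with time-dependent coefficients. A composition of maps `G₄`, `G₀`, `G₋₄`
integrates it, its parameters being governed by a Riccati equation followed by two quadratures.
The remaining factor `flow κ` is not linear over `Sc` unless `κ = 0`.
-/

noncomputable section

namespace AlgCR

open scoped DualNumber

@[simp] lemma fst_mkSc (a b : ℂ) : (mkSc a b).fst = a := by simp [mkSc]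
@[simp] lemma snd_mkSc (a b : ℂ) : (mkSc a b).snd = b := by simp [mkSc]
@[simp] lemma fst_ofS (X : S) : (ofS X).fst = X.fst := by simp [ofS]
@[simp] lemma snd_ofS (X : S) : (ofS X).snd = X.snd := by simp [ofS]
@[simp] lemma fst_conjS (Z : Sc) : (conjS Z).fst = star Z.fst := by simp [conjS]
@[simp] lemma snd_conjS (Z : Sc) : (conjS Z).snd = star Z.snd := by simp [conjS]
@[simp] lemma fst_imS (Z : Sc) : (imS Z).fst = Z.fst.im := by simp [imS]
@[simp] lemma snd_imS (Z : Sc) : (imS Z).snd = Z.snd.im := by simp [imS]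

@[simp] lemma fst_ofNat (k : ℕ) [k.AtLeastTwo] : (ofNat(k) : Sc).fst = ofNat(k) :=
  TrivSqZeroExt.fst_natCast k

@[simp] lemma snd_ofNat (k : ℕ) [k.AtLeastTwo] : (ofNat(k) : Sc).snd = 0 :=
  TrivSqZeroExt.snd_natCast k

lemma norm_Sc (Z : Sc) : ‖Z‖ = ‖Z.fst‖ + ‖Z.snd‖ := TrivSqZeroExt.norm_def Z

lemma isUnit_iff_fst_ne_zero {Z : Sc} : IsUnit Z ↔ Z.fst ≠ 0 :=
  TrivSqZeroExt.isUnit_iff_isUnit_fst.trans isUnit_iff_ne_zero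

instance : StarRing Sc where
  star := conjS
  star_involutive Z := by ext <;> simp
  star_mul Z W := by ext <;> simp [mul_comm, add_comm]
  star_add Z W := by ext <;> simp

lemma star_eq_conjS (Z : Sc) : star Z = conjS Z := rfl

@[simp] lemma fst_star (Z : Sc) : (star Z).fst = star Z.fst := fst_conjS Z
@[simp] lemma snd_star (Z : Sc) : (star Z).snd = star Z.snd := snd_conjS Z

instance : StarModule ℂ Sc where
  star_smul c Z := by ext <;> simp

instance : StarModule ℝ Sc where
  star_smul c Z := by ext <;> simp

instance : NormedStarGroup Sc := ⟨fun Z => by simp [norm_Sc]⟩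

@[simp] lemma star_mkSc (a b : ℂ) : star (mkSc a b) = mkSc (star a) (star b) := by
  ext <;> simp

@[simp] lemma star_ofS (X : S) : star (ofS X) = ofS X := by ext <;> simp

lemma exists_ofS_eq {Z : Sc} (h : star Z = Z) : ∃ X : S, ofS X = Z := by
  have h₁ : star Z.fst = Z.fst := by rw [← fst_star, h]
  have h₂ : star Z.snd = Z.snd := by rw [← snd_star, h]
  refine ⟨TrivSqZeroExt.inl Z.fst.re + TrivSqZeroExt.inr Z.snd.re, ?_⟩
  ext
  · simpa using Complex.conj_eq_iff_re.1 h₁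
  · simpa using Complex.conj_eq_iff_re.1 h₂

/-- The imaginary unit of `Sc`, as an element, so that identities in `Sc` can be normalized as
identities in a commutative ring. -/
def iS : Sc := mkSc Complex.I 0

@[simp] lemma fst_iS : iS.fst = Complex.I := by simp [iS]
@[simp] lemma snd_iS : iS.snd = 0 := by simp [iS]
@[simp] lemma star_iS : star iS = -iS := by ext <;> simp

lemma iS_sq : iS ^ 2 = -1 := by
  rw [sq]
  ext <;> simp

lemma isUnit_iS : IsUnit iS := isUnit_iff_fst_ne_zero.2 (by simp)

lemma isUnit_two : IsUnit (2 : Sc) :=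
  map_ofNat (algebraMap ℂ Sc) 2 ▸ (IsUnit.mk0 (2 : ℂ) two_ne_zero).map (algebraMap ℂ Sc)

lemma neg_half_smul_iS_mul_sub_eq_zero_iff {x y : Sc} :
    (-(1 / 2) : ℝ) • (iS * x) - y = 0 ↔ x = 2 * iS * y := by
  have half : (2 : Sc) * ((-(1 / 2) : ℝ) • (iS * x)) = -(iS * x) := by
    rw [two_mul, ← add_smul]
    norm_num
  constructor <;> intro h
  · linear_combination 2 * iS * h - iS * half + x * iS_sq
  · refine isUnit_two.mul_left_cancel ?_
    linear_combination half - iS * h - 2 * y * iS_sq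

lemma rho_eq (p : Sc × Sc) :
    rho p = (-(1 / 2) : ℝ) • (iS * (p.2 - star p.2)) - p.1 ^ 2 * star p.1 ^ 2 := by
  have : ofS (imS p.2) = (-(1 / 2) : ℝ) • (iS * (p.2 - star p.2)) := by
    ext <;> apply Complex.ext <;> simp <;> ring
  rw [rho, this, star_eq_conjS p.1]

lemma rho_eq_zero_iff (p : Sc × Sc) :
    rho p = 0 ↔ p.2 - star p.2 = 2 * iS * (p.1 ^ 2 * star p.1 ^ 2) := by
  rw [rho_eq, neg_half_smul_iS_mul_sub_eq_zero_iff]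

lemma fderiv_rho (p v : Sc × Sc) :
    fderiv ℝ rho p v = (-(1 / 2) : ℝ) • (iS * (v.2 - star v.2)) -
      2 * (p.1 * star p.1 ^ 2 * v.1 + p.1 ^ 2 * star p.1 * star v.1) := by
  have h₁ : HasFDerivAt (fun p : Sc × Sc => p.1) (ContinuousLinearMap.fst ℝ Sc Sc) p :=
    hasFDerivAt_fst
  have h₂ : HasFDerivAt (fun p : Sc × Sc => p.2) (ContinuousLinearMap.snd ℝ Sc Sc) p :=
    hasFDerivAt_snd
  have h := (((h₂.sub h₂.star).const_mul iS).const_smul (-(1 / 2) : ℝ)).sub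
    ((h₁.mul h₁).mul (h₁.star.mul h₁.star))
  have hrho : HasFDerivAt rho _ p := h.congr_of_eventuallyEq <| .of_forall fun q => by
    simp only [rho_eq, sq, Pi.sub_apply, Pi.smul_apply, Pi.mul_apply]
  rw [hrho.fderiv]
  simp only [Pi.mul_apply, smul_add, sub_apply, smul_apply, ContinuousLinearMap.coe_snd',
    ContinuousLinearMap.comp_apply, ContinuousLinearEquiv.coe_coe, starL'_apply, smul_eq_mul,
    add_apply, ContinuousLinearMap.coe_fst']
  ring

lemma fderiv_rho_eq_zero_iff (p v : Sc × Sc) :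
    fderiv ℝ rho p v = 0 ↔ v.2 - star v.2 =
      4 * iS * (p.1 * star p.1 ^ 2 * v.1 + p.1 ^ 2 * star p.1 * star v.1) := by
  rw [fderiv_rho, neg_half_smul_iS_mul_sub_eq_zero_iff, ← mul_assoc,
    show 2 * iS * 2 = 4 * iS by ring]

lemma rho_mkSc (z₁ z₂ w₁ w₂ : ℂ) : rho (mkSc z₁ z₂, mkSc w₁ w₂) =
    mkSc ((w₁.im - ‖z₁‖ ^ 4 : ℝ) : ℂ) ((w₂.im - 4 * (z₁ ^ 2 * star z₁ * star z₂).re : ℝ) : ℂ) := by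
  have norm_pow : z₁ ^ 2 * star z₁ ^ 2 = ((‖z₁‖ ^ 4 : ℝ) : ℂ) := by
    rw [← mul_pow, Complex.star_def, Complex.mul_conj, Complex.normSq_eq_norm_sq]
    push_cast
    ring
  have add_star := Complex.add_conj (z₁ ^ 2 * star z₁ * star z₂)
  simp only [map_mul, map_pow, Complex.star_def, Complex.conj_conj] at norm_pow add_star
  ext
  · simp only [rho, TrivSqZeroExt.fst_sub, fst_ofS, fst_imS, fst_mkSc, TrivSqZeroExt.fst_mul,
      TrivSqZeroExt.fst_pow, fst_conjS, Complex.star_def, norm_pow, Complex.ofReal_sub]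
  · simp only [rho, pow_two, TrivSqZeroExt.snd_sub, TrivSqZeroExt.snd_mul, TrivSqZeroExt.fst_mul,
      MulOpposite.smul_eq_mul_unop, MulOpposite.unop_op, smul_eq_mul, snd_ofS, snd_imS, fst_conjS,
      snd_conjS, fst_mkSc, snd_mkSc, Complex.star_def]
    simp only [pow_two] at add_star
    push_cast at add_star ⊢
    linear_combination -2 * add_star

lemma mkSc_mem_Q_iff (z₁ z₂ w₁ w₂ : ℂ) : (mkSc z₁ z₂, mkSc w₁ w₂) ∈ Q ↔
    w₁.im = ‖z₁‖ ^ 4 ∧ w₂.im = 4 * (z₁ ^ 2 * star z₁ * star z₂).re := by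
  rw [Q, Set.mem_ofPred_eq, rho_mkSc, TrivSqZeroExt.ext_iff, fst_mkSc, snd_mkSc,
    TrivSqZeroExt.fst_zero, TrivSqZeroExt.snd_zero, Complex.ofReal_eq_zero, Complex.ofReal_eq_zero,
    sub_eq_zero, sub_eq_zero]

section IdentityPrinciple

variable {E F : Type*} [NormedAddCommGroup E] [NormedSpace ℂ E]
  [NormedAddCommGroup F] [NormedSpace ℂ F]

lemma tendsto_ofReal_nhdsNE_zero :
    Tendsto (fun x : ℝ => (x : ℂ)) (𝓝[≠] 0) (𝓝[≠] 0) :=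
  tendsto_nhdsWithin_of_tendsto_nhds_of_eventually_within _
    ((Complex.continuous_ofReal.tendsto' 0 0 Complex.ofReal_zero).mono_left nhdsWithin_le_nhds)
    (eventually_mem_nhdsWithin.mono fun _ hx => Complex.ofReal_ne_zero.2 hx)

lemma eqOn_zero_of_eventually_ofReal_eq_zero [CompleteSpace F] {φ : ℂ → F} {U : Set ℂ}
    (hφ : DifferentiableOn ℂ φ U) (hU : IsOpen U) (hUc : IsPreconnected U) (h0 : (0 : ℂ) ∈ U)
    (h : ∀ᶠ x : ℝ in 𝓝 0, φ x = 0) : Set.EqOn φ 0 U :=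
  (hφ.analyticOnNhd hU).eqOn_zero_of_preconnected_of_frequently_eq_zero hUc h0
    (tendsto_ofReal_nhdsNE_zero.frequently (h.filter_mono nhdsWithin_le_nhds).frequently)

/-- The half-sum `(e + σ e) / 2`, fixed by the conjugation `σ`. -/
def conjRe (σ : E →L⋆[ℂ] E) (e : E) : E := (1 / 2 : ℂ) • (e + σ e)

/-- The quotient `(e - σ e) / 2i`, fixed by the conjugation `σ`. -/
def conjIm (σ : E →L⋆[ℂ] E) (e : E) : E := (-Complex.I / 2) • (e - σ e)

variable {σ : E →L⋆[ℂ] E}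

lemma conjRe_add_I_smul_conjIm (e : E) : conjRe σ e + Complex.I • conjIm σ e = e := by
  have : Complex.I * (-Complex.I / 2) = 1 / 2 := by linear_combination (-1 / 2) * Complex.I_sq
  rw [conjRe, conjIm, smul_smul, this, ← smul_add, add_add_sub_cancel, ← two_smul ℂ e, smul_smul]
  norm_num

lemma map_conjRe_add_ofReal_smul_conjIm (hσ : Function.Involutive σ) (e : E) (x : ℝ) :
    σ (conjRe σ e + (x : ℂ) • conjIm σ e) = conjRe σ e + (x : ℂ) • conjIm σ e := by
  simp only [conjRe, conjIm, map_add, map_sub, map_smulₛₗ, hσ e, map_div₀, map_neg, map_one,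
    map_ofNat, Complex.conj_I, Complex.conj_ofReal]
  module

/-- Fixed vectors of a conjugation form a totally real subspace of maximal dimension: along
`v + l w` with `v, w` fixed, a holomorphic function vanishing for real `l` vanishes at `l = i`. -/
lemma eventually_eq_zero_of_conj_fixed [CompleteSpace F] (hσ : Function.Involutive σ) {Ψ : E → F}
    (hd : ∀ᶠ e in 𝓝 0, DifferentiableAt ℂ Ψ e) (h0 : ∀ᶠ e in 𝓝 0, σ e = e → Ψ e = 0) :
    ∀ᶠ e in 𝓝 0, Ψ e = 0 := by
  obtain ⟨r, hr, hball⟩ := Metric.eventually_nhds_iff_ball.1 (hd.and h0)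
  have small : ∀ᶠ e in 𝓝 (0 : E), ‖conjRe σ e‖ + 2 * ‖conjIm σ e‖ < r := by
    have : Continuous fun e : E => ‖conjRe σ e‖ + 2 * ‖conjIm σ e‖ := by
      unfold conjRe conjIm
      fun_prop
    exact (this.tendsto' 0 0 (by simp [conjRe, conjIm])).eventually_lt_const hr
  filter_upwards [small] with e he
  have line_mem : ∀ l ∈ Metric.ball (0 : ℂ) 2,
      conjRe σ e + l • conjIm σ e ∈ Metric.ball (0 : E) r := by
    intro l hl
    rw [mem_ball_zero_iff] at hl ⊢
    calc ‖conjRe σ e + l • conjIm σ e‖ ≤ ‖conjRe σ e‖ + ‖l‖ * ‖conjIm σ e‖ :=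
          (norm_add_le _ _).trans_eq (by rw [norm_smul])
      _ ≤ ‖conjRe σ e‖ + 2 * ‖conjIm σ e‖ := by gcongr
      _ < r := he
  have hφ : DifferentiableOn ℂ (fun l : ℂ => Ψ (conjRe σ e + l • conjIm σ e))
      (Metric.ball 0 2) := fun l hl =>
    ((hball _ (line_mem l hl)).1.comp l (by fun_prop)).differentiableWithinAt
  have zero_on_real : ∀ᶠ x : ℝ in 𝓝 0, Ψ (conjRe σ e + (x : ℂ) • conjIm σ e) = 0 := by
    have : ∀ᶠ x : ℝ in 𝓝 0, (x : ℂ) ∈ Metric.ball (0 : ℂ) 2 :=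
      (Complex.continuous_ofReal.tendsto' 0 0 Complex.ofReal_zero).eventually
        (Metric.ball_mem_nhds _ two_pos)
    filter_upwards [this] with x hx
    exact (hball _ (line_mem x hx)).2 (map_conjRe_add_ofReal_smul_conjIm hσ e x)
  have := eqOn_zero_of_eventually_ofReal_eq_zero hφ Metric.isOpen_ball
    (convex_ball _ _).isPreconnected (Metric.mem_ball_self two_pos) zero_on_real
    (show Complex.I ∈ Metric.ball (0 : ℂ) 2 by simp)
  simpa only [conjRe_add_I_smul_conjIm, Pi.zero_apply] using this

end IdentityPrinciple

/-- The tangency equation for the field `f` on the complexification of `Q`, where `star p.1` and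
`star p.2` have become independent variables `ζ, ω`; it holds in the polydisc of radius `r`. -/
structure IsPolarizedTangent (f : Sc × Sc → Sc × Sc) (r : ℝ) : Prop where
  pos : 0 < r
  differentiableAt : ∀ z w : Sc, ‖z‖ < r → ‖w‖ < r → DifferentiableAt ℂ f (z, w)
  eqn : ∀ z ζ w ω : Sc, ‖z‖ < r → ‖ζ‖ < r → ‖w‖ < r → ‖ω‖ < r →
    w - ω = 2 * iS * (z ^ 2 * ζ ^ 2) →
    (f (z, w)).2 - star (f (star ζ, star ω)).2 =
      4 * iS * (z * ζ ^ 2 * (f (z, w)).1 + z ^ 2 * ζ * star (f (star ζ, star ω)).1)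

section Polarization

/-- The first point `(z, w)` of the pair `(z, w), (ζ, ω)` with `(w + ω) / 2 = u` and
`w - ω = 2 i z² ζ²`, as a function of `(z, ζ, u)`. -/
def polarPt (e : Sc × Sc × Sc) : Sc × Sc := (e.1, e.2.2 + iS * (e.1 ^ 2 * e.2.1 ^ 2))

/-- The exchange `(z, ζ, u) ↦ (ζ, z, u)`. -/
def polarSwap : Sc × Sc × Sc →L[ℂ] Sc × Sc × Sc :=
  ((ContinuousLinearMap.fst ℂ Sc Sc).comp (.snd ℂ Sc (Sc × Sc))).prod
    ((ContinuousLinearMap.fst ℂ Sc (Sc × Sc)).prod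
      ((ContinuousLinearMap.snd ℂ Sc Sc).comp (.snd ℂ Sc (Sc × Sc))))

/-- The conjugation `(z, ζ, u) ↦ (ζ̄, z̄, ū)`. -/
def polarConj : Sc × Sc × Sc →L⋆[ℂ] Sc × Sc × Sc :=
  ((starL ℂ : (Sc × Sc × Sc) ≃L⋆[ℂ] Sc × Sc × Sc) : Sc × Sc × Sc →L⋆[ℂ] Sc × Sc × Sc).comp
    polarSwap

@[simp] lemma polarConj_apply (z ζ u : Sc) :
    polarConj (z, ζ, u) = (star ζ, star z, star u) := rfl

lemma involutive_polarConj : Function.Involutive polarConj := fun e => by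
  obtain ⟨z, ζ, u⟩ := e
  simp

lemma differentiable_polarPt : Differentiable ℂ polarPt := by
  have : Differentiable ℂ fun e : Sc × Sc × Sc => iS * (e.1 ^ 2 * e.2.1 ^ 2) :=
    ((differentiable_fst.pow 2).mul (differentiable_snd.fst.pow 2)).const_mul iS
  exact differentiable_fst.prodMk (differentiable_snd.snd.add this)

/-- The difference of the two sides of `IsPolarizedTangent.eqn`. -/
def polarDefect (f : Sc × Sc → Sc × Sc) (e : Sc × Sc × Sc) : Sc :=
  (f (polarPt e)).2 - star (f (polarPt (polarConj e))).2 -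
    4 * iS * (e.1 * e.2.1 ^ 2 * (f (polarPt e)).1 +
      e.1 ^ 2 * e.2.1 * star (f (polarPt (polarConj e))).1)

variable {f : Sc × Sc → Sc × Sc}

lemma differentiableAt_star_comp_polarConj {e : Sc × Sc × Sc} {g : Sc × Sc × Sc → Sc × Sc}
    (h : DifferentiableAt ℂ g (polarConj e)) :
    DifferentiableAt ℂ (fun e => star (g (polarConj e))) e := by
  have h' : DifferentiableAt ℂ (star ∘ g ∘ star) (star (polarConj e)) := h.star_star
  rw [show star (polarConj e) = polarSwap e from star_star _] at h'
  exact h'.comp e polarSwap.differentiableAt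

lemma differentiableAt_polarDefect {e : Sc × Sc × Sc} (h : DifferentiableAt ℂ f (polarPt e))
    (h' : DifferentiableAt ℂ f (polarPt (polarConj e))) :
    DifferentiableAt ℂ (polarDefect f) e := by
  have hf : DifferentiableAt ℂ (fun e => f (polarPt e)) e :=
    h.comp e differentiable_polarPt.differentiableAt
  have hf' : DifferentiableAt ℂ (fun e => star (f (polarPt (polarConj e)))) e :=
    differentiableAt_star_comp_polarConj
      (h'.comp (polarConj e) differentiable_polarPt.differentiableAt)
  have hz : DifferentiableAt ℂ (fun e : Sc × Sc × Sc => e.1) e := differentiableAt_fst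
  have hζ : DifferentiableAt ℂ (fun e : Sc × Sc × Sc => e.2.1) e := differentiableAt_snd.fst
  exact (hf.snd.sub hf'.snd).sub ((((hz.mul (hζ.pow 2)).mul hf.fst).add
    (((hz.pow 2).mul hζ).mul hf'.fst)).const_mul (4 * iS))

lemma polarDefect_eq_zero_of_conj_fixed {e : Sc × Sc × Sc} (he : polarConj e = e)
    (ht : rho (polarPt e) = 0 → fderiv ℝ rho (polarPt e) (f (polarPt e)) = 0) :
    polarDefect f e = 0 := by
  obtain ⟨z, ζ, u⟩ := e
  have he' := he
  simp only [polarConj_apply, Prod.mk.injEq] at he'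
  obtain ⟨-, rfl, hu⟩ := he'
  rw [rho_eq_zero_iff, fderiv_rho_eq_zero_iff] at ht
  have tangent := ht (by
    simp only [polarPt, star_add, star_mul', star_iS, star_pow, star_star, hu]
    ring)
  rw [polarDefect, he, sub_eq_zero, tangent]
  rfl

lemma tendsto_polarPt_zero : Tendsto polarPt (𝓝 0) (𝓝 0) :=
  differentiable_polarPt.continuous.tendsto' 0 0 (by simp [polarPt])

lemma tendsto_polarConj_zero : Tendsto polarConj (𝓝 0) (𝓝 0) :=
  polarConj.continuous.tendsto' 0 0 (map_zero _)

lemma eventually_polarDefect_eq_zero (hf : ∀ᶠ p in 𝓝 0, DifferentiableAt ℂ f p)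
    (ht : ∀ᶠ p in 𝓝 0, rho p = 0 → fderiv ℝ rho p (f p) = 0) :
    ∀ᶠ e in 𝓝 0, polarDefect f e = 0 := by
  refine eventually_eq_zero_of_conj_fixed involutive_polarConj ?_ ?_
  · filter_upwards [tendsto_polarPt_zero.eventually hf,
      (tendsto_polarPt_zero.comp tendsto_polarConj_zero).eventually hf] with e h h'
    exact differentiableAt_polarDefect h h'
  · filter_upwards [tendsto_polarPt_zero.eventually ht] with e h he
    exact polarDefect_eq_zero_of_conj_fixed he h

theorem exists_isPolarizedTangent (hf : AnalyticAt ℂ f 0)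
    (ht : ∀ᶠ p in 𝓝 0, rho p = 0 → fderiv ℝ rho p (f p) = 0) :
    ∃ r, IsPolarizedTangent f r := by
  have hd : ∀ᶠ p in 𝓝 0, DifferentiableAt ℂ f p :=
    hf.eventually_analyticAt.mono fun _ h => h.differentiableAt
  have toDefect : Tendsto (fun q : Sc × Sc × Sc × Sc => (q.1, q.2.1,
      q.2.2.1 - iS * (q.1 ^ 2 * q.2.1 ^ 2))) (𝓝 0) (𝓝 0) :=
    Continuous.tendsto' (by fun_prop) 0 0 (by simp)
  obtain ⟨r₁, hr₁, diff⟩ := Metric.eventually_nhds_iff_ball.1 hd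
  obtain ⟨r₂, hr₂, defect⟩ := Metric.eventually_nhds_iff_ball.1
    (toDefect.eventually (eventually_polarDefect_eq_zero hd ht))
  refine ⟨min r₁ r₂, lt_min hr₁ hr₂, fun z w hz hw => diff _ ?_, ?_⟩
  · simp only [mem_ball_zero_iff, Prod.norm_def, max_lt_iff]
    exact ⟨hz.trans_le (min_le_left _ _), hw.trans_le (min_le_left _ _)⟩
  intro z ζ w ω hz hζ hw hω h
  have key := defect (z, ζ, w, ω) (by
    simp only [mem_ball_zero_iff, Prod.norm_def, max_lt_iff]
    exact ⟨hz.trans_le (min_le_right _ _), hζ.trans_le (min_le_right _ _),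
      hw.trans_le (min_le_right _ _), hω.trans_le (min_le_right _ _)⟩)
  have pt : polarPt (z, ζ, w - iS * (z ^ 2 * ζ ^ 2)) = (z, w) := by simp [polarPt]
  have pt' : polarPt (polarConj (z, ζ, w - iS * (z ^ 2 * ζ ^ 2))) = (star ζ, star ω) := by
    have : ω = w - 2 * iS * (z ^ 2 * ζ ^ 2) := by linear_combination -h
    rw [polarConj_apply, polarPt, this]
    simp only [star_sub, star_mul', star_iS, star_pow, star_ofNat]
    congr 1
    ring
  simpa only [polarDefect, pt, pt', sub_eq_zero] using key

end Polarization

section FirstOrderExpansion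

variable {𝕜 V : Type*} [NontriviallyNormedField 𝕜] [NormedAddCommGroup V] [NormedSpace 𝕜 V]

lemma eq_add_of_sq_smul_eq {s x y : 𝕜 → V} {s₀ x₀ y' : V}
    (hs : Tendsto s (𝓝[≠] 0) (𝓝 s₀)) (hx : Tendsto x (𝓝[≠] 0) (𝓝 x₀)) (hy : HasDerivAt y y' 0)
    (h : ∀ᶠ t in 𝓝[≠] 0, t ^ 2 • s t = t ^ 2 • x t + t • y t) : s₀ = x₀ + y' := by
  have hsx := hs.sub hx
  have divided : ∀ᶠ t in 𝓝[≠] (0 : 𝕜), t • (s t - x t) = y t := by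
    filter_upwards [h, eventually_mem_nhdsWithin] with t ht ht0
    refine smul_right_injective V ht0 ?_
    simp only [smul_sub, smul_smul, ← sq, ht, add_sub_cancel_left]
  have y_zero : y 0 = 0 := by
    have lim := (tendsto_id.mono_left nhdsWithin_le_nhds).smul hsx |>.congr' divided
    rw [zero_smul] at lim
    exact tendsto_nhds_unique (hy.continuousAt.tendsto.mono_left nhdsWithin_le_nhds) lim
  have slope_eq : ∀ᶠ t in 𝓝[≠] (0 : 𝕜), slope y 0 t = s t - x t := by
    filter_upwards [divided, eventually_mem_nhdsWithin] with t ht ht0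
    rw [slope_def_module, y_zero, sub_zero, sub_zero, ← ht, inv_smul_smul₀ ht0]
  rw [← sub_eq_iff_eq_add']
  exact tendsto_nhds_unique hsx ((hasDerivAt_iff_tendsto_slope.1 hy).congr' slope_eq)

lemma tendsto_sq_nhdsNE_zero : Tendsto (fun t : 𝕜 => t ^ 2) (𝓝[≠] 0) (𝓝[≠] 0) :=
  tendsto_nhdsWithin_of_tendsto_nhds_of_eventually_within _
    (((continuous_pow 2).tendsto' 0 0 (by simp)).mono_left nhdsWithin_le_nhds)
    (eventually_mem_nhdsWithin.mono fun _ ht => pow_ne_zero 2 ht)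

lemma tendsto_inv_sq_smul_sub {W : Type*} [NormedAddCommGroup W]
    [NormedSpace 𝕜 W] {g : V → W} {w : V} (hg : DifferentiableAt 𝕜 g w) (d : V) :
    Tendsto (fun t : 𝕜 => (t ^ 2)⁻¹ • (g (w + t ^ 2 • d) - g w)) (𝓝[≠] 0)
      (𝓝 (fderiv 𝕜 g w d)) := by
  have := (hasDerivAt_iff_tendsto_slope.1 (hg.hasFDerivAt.hasLineDerivAt d)).comp
    (tendsto_sq_nhdsNE_zero (𝕜 := 𝕜))
  simpa [Function.comp_def, slope_def_module] using this

end FirstOrderExpansion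

section NormalForm

variable {f : Sc × Sc → Sc × Sc} {r : ℝ}

lemma IsPolarizedTangent.snd_eq_star (h : IsPolarizedTangent f r) {z w : Sc} (hz : ‖z‖ < r)
    (hw : ‖w‖ < r) : (f (z, w)).2 = star (f (0, star w)).2 := by
  have := h.eqn z 0 w w hz (by simpa using h.pos) hw hw (by simp)
  simpa [sub_eq_zero] using this

lemma IsPolarizedTangent.snd_eq (h : IsPolarizedTangent f r) {z w : Sc} (hz : ‖z‖ < r)
    (hw : ‖w‖ < r) : (f (z, w)).2 = (f (0, w)).2 := by
  rw [h.snd_eq_star hz hw, h.snd_eq_star (by simpa using h.pos) hw]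

lemma IsPolarizedTangent.eqn' (h : IsPolarizedTangent f r) {z ζ w ω : Sc} (hz : ‖z‖ < r)
    (hζ : ‖ζ‖ < r) (hw : ‖w‖ < r) (hω : ‖ω‖ < r) (hwω : w - ω = 2 * iS * (z ^ 2 * ζ ^ 2)) :
    (f (0, w)).2 - (f (0, ω)).2 =
      4 * iS * (z * ζ ^ 2 * (f (z, w)).1 + z ^ 2 * ζ * star (f (star ζ, star ω)).1) := by
  rw [← h.eqn z ζ w ω hz hζ hw hω hwω, h.snd_eq hz hw,
    h.snd_eq (z := star ζ) (w := star ω) (by rwa [norm_star]) (by rwa [norm_star]),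
    h.snd_eq_star (by simpa using h.pos) hω]

lemma I_smul_eq (Z : Sc) : Complex.I • Z = iS * Z := by ext <;> simp

lemma IsPolarizedTangent.differentiableAt_star_fst_smul_one (h : IsPolarizedTangent f r) {ω : Sc}
    (hω : ‖ω‖ < r) :
    DifferentiableAt ℂ (fun t : ℂ => star (f (star (t • (1 : Sc)), star ω)).1) 0 := by
  have slice : DifferentiableAt ℂ (fun ζ => (f (ζ, star ω)).1) (star 0) := by
    rw [star_zero]
    exact (h.differentiableAt 0 (star ω) (by simpa using h.pos) (by simpa using hω)).fst.comp
      (0 : Sc) (f := fun ζ => (ζ, star ω)) (by fun_prop)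
  have conj_slice := slice.star_star
  rw [star_star] at conj_slice
  exact DifferentiableAt.comp (g := star ∘ (fun ζ => (f (ζ, star ω)).1) ∘ star) 0
    (by simpa using conj_slice) (by fun_prop)

/-- Comparing the terms of order two in `ε` at `ζ = ε` and `w = ω + 2 i ε² z²`. -/
lemma IsPolarizedTangent.fderiv_snd_apply_sq (h : IsPolarizedTangent f r) {ω : Sc}
    (hω : ‖ω‖ < r) : ∃ D : Sc, ∀ z, ‖z‖ < r →
      fderiv ℂ (fun w => (f (0, w)).2) ω (z ^ 2) = 2 * (z * (f (z, ω)).1 + z ^ 2 * D) := by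
  have diff (z w : Sc) (hz : ‖z‖ < r) (hw : ‖w‖ < r) :
      DifferentiableAt ℂ (fun w => f (z, w)) w :=
    (h.differentiableAt z w hz hw).comp w (by fun_prop)
  refine ⟨deriv (fun t : ℂ => star (f (star (t • (1 : Sc)), star ω)).1) 0, fun z hz => ?_⟩
  set d : Sc := 2 * iS * z ^ 2 with hd
  have curve : Tendsto (fun t : ℂ => ω + t ^ 2 • d) (𝓝 0) (𝓝 ω) :=
    Continuous.tendsto' (by fun_prop) _ _ (by simp)
  have first : Tendsto (fun t : ℂ => 4 * iS * (z * (f (z, ω + t ^ 2 • d)).1)) (𝓝[≠] 0)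
      (𝓝 (4 * iS * (z * (f (z, ω)).1))) :=
    ((((diff z ω hz hω).fst.continuousAt.tendsto.comp curve).const_mul z).const_mul
      (4 * iS)).mono_left nhdsWithin_le_nhds
  have key := eq_add_of_sq_smul_eq
    (tendsto_inv_sq_smul_sub (diff 0 ω (by simpa using h.pos) hω).snd d) first
    (((h.differentiableAt_star_fst_smul_one hω).hasDerivAt.const_mul (z ^ 2)).const_mul (4 * iS))
    (by
      have small : ∀ᶠ t : ℂ in 𝓝 0, ‖t • (1 : Sc)‖ < r :=
        (Continuous.tendsto' (by fun_prop) 0 0 (by simp)).eventually_lt_const h.pos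
      filter_upwards [nhdsWithin_le_nhds small,
        nhdsWithin_le_nhds (curve.norm.eventually_lt_const hω), eventually_mem_nhdsWithin]
        with t ht hw ht0
      have eqn := h.eqn' (ζ := t • 1) hz ht hw hω (by
        rw [hd, smul_pow, one_pow, mul_smul_comm, mul_one, mul_smul_comm]
        simp)
      rw [smul_inv_smul₀ (pow_ne_zero 2 ht0), eqn]
      simp only [smul_pow, one_pow, mul_smul_comm, mul_one, smul_mul_assoc, mul_add])
  rw [hd, mul_assoc, two_mul, ← I_smul_eq, map_add, map_smul, I_smul_eq] at key
  refine (isUnit_two.mul isUnit_iS).mul_left_cancel ?_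
  linear_combination key

lemma dense_fst_ne_zero : Dense {z : Sc | z.fst ≠ 0} :=
  (dense_compl_singleton (0 : ℂ)).preimage
    (isOpenMap_fst : IsOpenMap (TrivSqZeroExt.fst : Sc → ℂ))

lemma eqOn_ball_of_eqOn_fst_ne_zero {V : Type*} [TopologicalSpace V] [T2Space V] {F G : Sc → V}
    (hF : ContinuousOn F (Metric.ball 0 r)) (hG : ContinuousOn G (Metric.ball 0 r))
    (h : ∀ z ∈ Metric.ball (0 : Sc) r, z.fst ≠ 0 → F z = G z) :
    Set.EqOn F G (Metric.ball 0 r) :=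
  Set.EqOn.of_subset_closure (fun z hz => h z hz.1 hz.2) hF hG Set.inter_subset_left
    (dense_fst_ne_zero.open_subset_closure_inter Metric.isOpen_ball)

/-- The quadratic form `L (z²)` can be divisible by `z` only if `(L ε).fst = 0`. -/
lemma exists_eq_of_mul_self_eq {F : Sc → Sc} (hr : 0 < r)
    (hF : ContinuousOn F (Metric.ball 0 r)) (L : Sc →ₗ[ℂ] Sc)
    (h : ∀ z ∈ Metric.ball (0 : Sc) r, z * F z = L (z ^ 2)) :
    ∃ (a : Sc) (q : ℂ), ∀ z ∈ Metric.ball (0 : Sc) r, F z = z * a + mkSc 0 (z.snd * q) := by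
  have L_sq (z : Sc) : L (z ^ 2) = z.fst ^ 2 • L 1 + (2 * z.fst * z.snd) • L ε := by
    rw [← map_smul, ← map_smul, ← map_add]
    congr 1
    ext <;> simp [sq]
    ring
  have continuous_fst' : Continuous (TrivSqZeroExt.fst : Sc → ℂ) := TrivSqZeroExt.continuous_fst
  have continuous_snd' : Continuous (TrivSqZeroExt.snd : Sc → ℂ) := TrivSqZeroExt.continuous_snd
  have fst_eqn (z) (hz : z ∈ Metric.ball (0 : Sc) r) :
      z.fst * (F z).fst = z.fst ^ 2 * (L 1).fst + 2 * z.fst * z.snd * (L ε).fst := by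
    simpa [L_sq] using congrArg TrivSqZeroExt.fst (h z hz)
  have snd_eqn (z) (hz : z ∈ Metric.ball (0 : Sc) r) : z.fst * (F z).snd + z.snd * (F z).fst =
      z.fst ^ 2 * (L 1).snd + 2 * z.fst * z.snd * (L ε).snd := by
    simpa [L_sq, mul_comm (F z).fst] using congrArg TrivSqZeroExt.snd (h z hz)
  have fst_eq' : Set.EqOn (fun z => (F z).fst)
      (fun z => z.fst * (L 1).fst + 2 * z.snd * (L ε).fst) (Metric.ball 0 r) :=
    eqOn_ball_of_eqOn_fst_ne_zero (by fun_prop) (by fun_prop) fun z hz hz0 =>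
      mul_left_cancel₀ hz0 (by linear_combination fst_eqn z hz)
  have L_eps : (L ε).fst = 0 := by
    have small : mkSc 0 ((r / 2 : ℝ) : ℂ) ∈ Metric.ball (0 : Sc) r := by
      simp [norm_Sc, abs_of_pos hr, hr]
    have fst_F : (F _).fst = _ := fst_eq' small
    have := snd_eqn _ small
    rw [fst_F] at this
    simpa [hr.ne'] using this
  have fst_eq : Set.EqOn (fun z => (F z).fst) (fun z => z.fst * (L 1).fst) (Metric.ball 0 r) :=
    fun z hz => (fst_eq' hz).trans (by simp [L_eps])
  have snd_eq : Set.EqOn (fun z => (F z).snd) (fun z => z.fst * (L 1).snd +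
      z.snd * (2 * (L ε).snd - (L 1).fst)) (Metric.ball 0 r) :=
    eqOn_ball_of_eqOn_fst_ne_zero (by fun_prop) (by fun_prop) fun z hz hz0 =>
      mul_left_cancel₀ hz0 (by linear_combination snd_eqn z hz - z.snd * fst_eq hz)
  refine ⟨L 1, 2 * ((L ε).snd - (L 1).fst), fun z hz => ?_⟩
  ext
  · simpa using fst_eq hz
  · simp only [snd_eq hz, TrivSqZeroExt.snd_add, TrivSqZeroExt.snd_mul, smul_eq_mul,
      MulOpposite.smul_eq_mul_unop, MulOpposite.unop_op, snd_mkSc]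
    ring

theorem IsPolarizedTangent.exists_normalForm (h : IsPolarizedTangent f r) :
    ∃ (g a : Sc → Sc) (q : Sc → ℂ), ∀ z w : Sc, ‖z‖ < r → ‖w‖ < r →
      f (z, w) = (z * a w + mkSc 0 (z.snd * q w), g w) := by
  have fst_eq (w : Sc) (hw : ‖w‖ < r) : ∃ (a : Sc) (q : ℂ), ∀ z ∈ Metric.ball (0 : Sc) r,
      (f (z, w)).1 = z * a + mkSc 0 (z.snd * q) := by
    obtain ⟨D, hD⟩ := h.fderiv_snd_apply_sq hw
    refine exists_eq_of_mul_self_eq h.pos (fun z hz => ?_)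
      ((1 / 2 : ℂ) • (fderiv ℂ (fun w => (f (0, w)).2) w : Sc →ₗ[ℂ] Sc) -
        LinearMap.mulRight ℂ D) fun z hz => ?_
    · rw [mem_ball_zero_iff] at hz
      exact ((h.differentiableAt z w hz hw).fst.continuousAt.comp
        (f := fun z => (z, w)) (by fun_prop)).continuousWithinAt
    · rw [mem_ball_zero_iff] at hz
      simp only [LinearMap.sub_apply, LinearMap.smul_apply, ContinuousLinearMap.coe_coe,
        hD z hz, LinearMap.mulRight_apply, two_mul, smul_add]
      module
  choose! a q haq using fst_eq
  refine ⟨fun w => (f (0, w)).2, a, q, fun z w hz hw => ?_⟩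
  rw [← haq w hw z (mem_ball_zero_iff.2 hz)]
  exact Prod.ext rfl (h.snd_eq hz hw)

end NormalForm

section SHolomorphic

lemma SHolFun.congr {u v : Sc × Sc → Sc} (hu : SHolFun u) (h : u =ᶠ[𝓝 0] v) : SHolFun v := by
  obtain ⟨c, hc⟩ := hu
  refine ⟨c, ?_⟩
  filter_upwards [hc, h] with p hp huv
  rwa [← huv]

lemma sHolFun_monomial (a : Sc) (j k : ℕ) : SHolFun fun p => a * p.1 ^ j * p.2 ^ k := by
  refine ⟨Pi.single (j, k) a, .of_forall fun p => ?_⟩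
  convert hasSum_single (j, k) fun i hi => ?_ using 1
  · simp
  · simp [Pi.single_eq_of_ne hi]

lemma sHol_germ_iff (h : Sc × Sc → Sc × Sc) :
    SHol (germ h) ↔ SHolFun (fun p => (h p).1) ∧ SHolFun (fun p => (h p).2) := by
  refine ⟨?_, fun ⟨h₁, h₂⟩ => ⟨h, rfl, h₁, h₂⟩⟩
  rintro ⟨f, hf, h₁, h₂⟩
  have hfh : f =ᶠ[𝓝 0] h := (Germ.coe_eq.1 hf).symm
  exact ⟨h₁.congr (hfh.fun_comp Prod.fst), h₂.congr (hfh.fun_comp Prod.snd)⟩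

lemma hasSum_pow_of_hasSum_zero {c : ℕ × ℕ → Sc} {Z s : Sc}
    (h : HasSum (fun j : ℕ × ℕ => c j * Z ^ j.1 * (0 : Sc) ^ j.2) s) :
    HasSum (fun k : ℕ => c (k, 0) * Z ^ k) s := by
  have injective : Function.Injective fun k : ℕ => (k, 0) := fun _ _ h => (Prod.mk.inj h).1
  rw [← injective.hasSum_iff] at h
  · simpa [Function.comp_def] using h
  · rintro ⟨j, k⟩ hjk
    have : k ≠ 0 := by
      rintro rfl
      exact hjk ⟨j, rfl⟩
    simp [this]

lemma SHolFun.exists_hasDerivAt {u : Sc × Sc → Sc} (hu : SHolFun u) :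
    ∃ c : Sc, ∀ d : Sc, HasDerivAt (fun t : ℂ => u (t • d, 0)) (c * d) 0 := by
  obtain ⟨c, hc⟩ := hu
  refine ⟨c (1, 0), fun d => ?_⟩
  let P : FormalMultilinearSeries ℂ ℂ Sc := fun k =>
    ContinuousMultilinearMap.mkPiRing ℂ (Fin k) (c (k, 0) * d ^ k)
  have coeff_P (k : ℕ) : P.coeff k = c (k, 0) * d ^ k := by
    simp [FormalMultilinearSeries.coeff, P]
  have tendsto_line : Tendsto (fun t : ℂ => ((t • d, 0) : Sc × Sc)) (𝓝 0) (𝓝 0) :=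
    Continuous.tendsto' (by fun_prop) 0 0 (by simp)
  have hP : HasFPowerSeriesAt (fun t : ℂ => u (t • d, 0)) P 0 := by
    rw [hasFPowerSeriesAt_iff]
    filter_upwards [tendsto_line.eventually hc] with t ht
    rw [zero_add]
    simpa only [coeff_P, smul_pow, mul_smul_comm] using hasSum_pow_of_hasSum_zero ht
  have derivative := hP.hasDerivAt
  rwa [show (P 1 fun _ => 1) = c (1, 0) * d ^ 1 from coeff_P 1, pow_one] at derivative

lemma SHolFun.map_eq_mul {u : Sc × Sc → Sc} (hu : SHolFun u) {Λ : Sc →ₗ[ℂ] Sc}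
    (h : ∀ Z, u (Z, 0) = Λ Z) (Z : Sc) : Λ Z = Λ 1 * Z := by
  obtain ⟨c, hc⟩ := hu.exists_hasDerivAt
  have hΛ (d : Sc) : Λ d = c * d := by
    refine HasDerivAt.unique ?_ (hc d)
    simp only [h, map_smul]
    simpa using (hasDerivAt_id (0 : ℂ)).smul_const (Λ d)
  rw [hΛ, hΛ, mul_one]

end SHolomorphic

section Fields

/-- The field `Z (b + e W) ∂/∂Z + (a + 2 (b + b̄) W + 2 e W²) ∂/∂W`. For real `a` and `e` it is
tangent to `Q`; the coefficients `a`, `b`, `e` have weights `-4`, `0`, `4`. -/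
def quadField (a b e : Sc) (p : Sc × Sc) : Sc × Sc :=
  (p.1 * (b + e * p.2), a + 2 * (b + star b) * p.2 + 2 * e * p.2 ^ 2)

/-- The real parametrization of the `S`-holomorphic fields tangent to `Q`. -/
def sField : S × Sc × S →ₗ[ℝ] (Sc × Sc → Sc × Sc) where
  toFun c := quadField (ofS c.1) c.2.1 (ofS c.2.2)
  map_add' c d := by
    have ofS_add (X Y : S) : ofS (X + Y) = ofS X + ofS Y := by ext <;> simp
    funext p
    ext1 <;> simp only [quadField, ofS_add, star_add, Prod.fst_add, Prod.snd_add, Pi.add_apply] <;>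
      ring
  map_smul' t c := by
    have ofS_smul (X : S) : ofS (t • X) = t • ofS X := by ext <;> simp
    funext p
    ext1 <;> simp only [quadField, ofS_smul, star_smul, star_trivial, Prod.smul_fst,
      Prod.smul_snd, Pi.smul_apply, RingHom.id_apply, ← smul_add, smul_mul_assoc, mul_smul_comm]

lemma sField_apply (c : S × Sc × S) : sField c = quadField (ofS c.1) c.2.1 (ofS c.2.2) := rfl

lemma analyticOnNhd_quadField (a b e : Sc) : AnalyticOnNhd ℂ (quadField a b e) Set.univ := by
  intro p _
  have hZ : AnalyticAt ℂ (fun p : Sc × Sc => p.1) p := analyticAt_fst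
  have hW : AnalyticAt ℂ (fun p : Sc × Sc => p.2) p := analyticAt_snd
  exact (hZ.mul (analyticAt_const.add (analyticAt_const.mul hW))).prod
    ((analyticAt_const.add (analyticAt_const.mul hW)).add (analyticAt_const.mul (hW.pow 2)))

lemma analyticOnNhd_X0 : AnalyticOnNhd ℂ X0 Set.univ := by
  let snd : Sc →L[ℂ] Sc := (TrivSqZeroExt.inrCLM ℂ ℂ).comp (TrivSqZeroExt.sndCLM ℂ ℂ)
  have : X0 = snd.prodMap snd := by
    funext p
    ext <;> simp [X0, snd, -DualNumber.inr_eq_smul_eps]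
  rw [this]
  exact ContinuousLinearMap.analyticOnNhd _ _

lemma fderiv_rho_quadField {a e : Sc} (ha : star a = a) (he : star e = e) (b : Sc) {p : Sc × Sc}
    (hp : rho p = 0) : fderiv ℝ rho p (quadField a b e p) = 0 := by
  rw [rho_eq_zero_iff] at hp
  rw [fderiv_rho_eq_zero_iff]
  simp only [quadField, star_add, star_mul, star_pow, star_star, ha, he, star_ofNat]
  linear_combination (2 * (b + star b) + 2 * e * (p.2 + star p.2)) * hp

lemma fderiv_rho_X0 {p : Sc × Sc} (hp : rho p = 0) : fderiv ℝ rho p (X0 p) = 0 := by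
  rw [rho_eq_zero_iff] at hp
  rw [fderiv_rho_eq_zero_iff]
  have snd_hp := congrArg TrivSqZeroExt.snd hp
  ext
  · simp [X0, pow_two]
  · simp [X0, pow_two] at snd_hp ⊢
    linear_combination snd_hp

lemma sField_mem_aut (c : S × Sc × S) : germ (sField c) ∈ aut rho :=
  ⟨sField c, rfl, analyticOnNhd_quadField _ _ _ 0 trivial,
    .of_forall fun _ hp => fderiv_rho_quadField (star_ofS _) (star_ofS _) _ hp⟩

lemma X0_mem_aut : germ X0 ∈ aut rho :=
  ⟨X0, rfl, analyticOnNhd_X0 0 trivial, .of_forall fun _ hp => fderiv_rho_X0 hp⟩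

lemma sHol_quadField (a b e : Sc) : SHol (germ (quadField a b e)) := by
  rw [sHol_germ_iff]
  constructor
  · refine ((sHolFun_monomial b 1 0).add (sHolFun_monomial e 1 1)).congr (.of_forall fun p => ?_)
    simp only [quadField]
    ring
  · refine (((sHolFun_monomial a 0 0).add (sHolFun_monomial (2 * (b + star b)) 0 1)).add
      (sHolFun_monomial (2 * e) 0 2)).congr (.of_forall fun p => ?_)
    simp only [quadField]
    ring

lemma sField_mem_autS (c : S × Sc × S) : germ (sField c) ∈ autS :=
  ⟨sField_mem_aut c, sHol_quadField _ _ _⟩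

lemma eq_zero_of_smul_X0_mem_autS {κ : ℝ} (h : κ • germ X0 ∈ autS) : κ = 0 := by
  let Λ : Sc →ₗ[ℂ] Sc := (κ : ℂ) • TrivSqZeroExt.inrHom ℂ ℂ ∘ₗ TrivSqZeroExt.sndHom ℂ ℂ
  have apply_zero (Z : Sc) : ((κ • X0) (Z, 0)).1 = Λ Z := by
    ext <;> simp [X0, Λ, -DualNumber.inr_eq_smul_eps, -Complex.coe_smul]
  have map_ε := ((sHol_germ_iff (κ • X0)).1 h.2).1.map_eq_mul apply_zero ε
  simpa [Λ, -DualNumber.inr_eq_smul_eps, -Complex.coe_smul] using congrArg TrivSqZeroExt.snd map_ε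

lemma autS_inf_span_X0 : autS ⊓ Submodule.span ℝ {germ X0} = ⊥ := by
  rw [eq_bot_iff]
  rintro _ ⟨hS, hX⟩
  obtain ⟨κ, rfl⟩ := Submodule.mem_span_singleton.1 hX
  simp [eq_zero_of_smul_X0_mem_autS hS]

lemma germ_X0_ne_zero : germ X0 ≠ 0 := by
  intro h
  have : (1 : ℝ) • germ X0 ∈ autS := by simp [h]
  exact one_ne_zero (eq_zero_of_smul_X0_mem_autS this)

end Fields

lemma map_pow_nhds_of_isUnit {𝕜 A : Type*} [NontriviallyNormedField 𝕜] [CharZero 𝕜]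
    [NormedCommRing A] [NormedAlgebra 𝕜 A] [CompleteSpace A] {n : ℕ} (hn : n ≠ 0) {x : A}
    (hx : IsUnit x) : map (· ^ n) (𝓝 x) = 𝓝 (x ^ n) := by
  refine (hasStrictFDerivAt_pow (𝕜 := 𝕜) n).map_nhds_eq_of_surj ?_
  have isUnit_n : IsUnit (n : A) := by
    simpa using (IsUnit.mk0 (n : 𝕜) (Nat.cast_ne_zero.2 hn)).map (algebraMap 𝕜 A)
  obtain ⟨u, hu⟩ := isUnit_n.mul (hx.pow (n - 1))
  refine LinearMap.range_eq_top.2 fun y => ⟨↑u⁻¹ * y, ?_⟩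
  simp [← hu]

/-- `w` and `ω` are the second coordinates of points `(v, w)`, `(v, ω)` of the polarized surface
`w - ω = 2 i z² ζ²`, with `v` invertible, in the polydisc of radius `r`. -/
def Linked (r : ℝ) (w ω : Sc) : Prop :=
  ‖w‖ < r ∧ ‖ω‖ < r ∧ ∃ v : Sc, IsUnit v ∧ ‖v‖ < r ∧ w - ω = 2 * iS * v ^ 4

section Linked

variable {r : ℝ} {w ω : Sc}

lemma Linked.isUnit_sub (h : Linked r w ω) : IsUnit (w - ω) := by
  obtain ⟨-, -, v, hv, -, hwω⟩ := h
  exact hwω ▸ (isUnit_two.mul isUnit_iS).mul (hv.pow 4)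

lemma Linked.symm (h : Linked r w ω) : Linked r ω w := by
  obtain ⟨hw, hω, v, hv, hvr, hwω⟩ := h
  obtain ⟨η, hη⟩ := IsAlgClosed.exists_pow_nat_eq (-1 : ℂ) (n := 4) (by norm_num)
  have norm_η : ‖η‖ = 1 := by
    rw [← pow_eq_one_iff_of_nonneg (norm_nonneg η) four_ne_zero, ← norm_pow, hη, norm_neg, norm_one]
  have η_ne_zero : η ≠ 0 := norm_ne_zero_iff.1 (norm_η ▸ one_ne_zero)
  have isUnit_smul : IsUnit (η • v) := by
    rw [Algebra.smul_def]
    exact ((IsUnit.mk0 η η_ne_zero).map _).mul hv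
  refine ⟨hω, hw, η • v, isUnit_smul, by simpa [norm_smul, norm_η], ?_⟩
  rw [smul_pow, hη, neg_one_smul, mul_neg, ← hwω, neg_sub]

lemma Linked.eventually (h : Linked r w ω) : ∀ᶠ w' in 𝓝 w, Linked r w' ω := by
  obtain ⟨hw, hω, v, hv, hvr, hwω⟩ := h
  have good : ∀ᶠ v' in 𝓝 v, IsUnit v' ∧ ‖v'‖ < r :=
    (Units.isOpen.eventually_mem hv).and (continuous_norm.continuousAt.eventually_lt_const hvr)
  have exists_root : ∀ᶠ y in 𝓝 (v ^ 4), ∃ v', (IsUnit v' ∧ ‖v'‖ < r) ∧ v' ^ 4 = y := by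
    rw [← map_pow_nhds_of_isUnit (𝕜 := ℂ) four_ne_zero hv]
    exact image_mem_map good
  have half_two : (1 / 2 : ℂ) • (2 : Sc) = 1 := by ext <;> simp
  have tendsto_fourth_power : Tendsto (fun w' => (1 / 2 : ℂ) • (-iS * (w' - ω))) (𝓝 w)
      (𝓝 (v ^ 4)) := by
    refine Continuous.tendsto' (by fun_prop) _ _ ?_
    rw [hwω, show -iS * (2 * iS * v ^ 4) = 2 * v ^ 4 by linear_combination -2 * v ^ 4 * iS_sq,
      ← smul_mul_assoc, half_two, one_mul]
  filter_upwards [tendsto_fourth_power.eventually exists_root,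
    continuous_norm.continuousAt.eventually_lt_const hw] with w' ⟨v', ⟨hv', hvr'⟩, root⟩ hw'
  refine ⟨hw', hω, v', hv', hvr', ?_⟩
  rw [root, mul_smul_comm, ← smul_mul_assoc, ← smul_mul_assoc, half_two]
  linear_combination (w' - ω) * iS_sq

lemma linked_algebraMap {s t : ℝ} (hst : s ≠ t) (hs : |s| < r) (ht : |t| < r)
    (hr : |s - t| < 2 * r ^ 4) : Linked r (algebraMap ℝ Sc s) (algebraMap ℝ Sc t) := by
  obtain ⟨c, hc⟩ := IsAlgClosed.exists_pow_nat_eq ((s - t : ℝ) / (2 * Complex.I) : ℂ)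
    (n := 4) (by norm_num)
  have norm_c : ‖c‖ ^ 4 < r ^ 4 := by
    rw [← norm_pow, hc, norm_div, norm_mul, Complex.norm_I, Complex.norm_real, Real.norm_eq_abs]
    norm_num
    linarith
  have c_ne_zero : c ≠ 0 := by
    rintro rfl
    have : ((s - t : ℝ) : ℂ) ≠ 0 := Complex.ofReal_ne_zero.2 (sub_ne_zero.2 hst)
    exact div_ne_zero this (mul_ne_zero two_ne_zero Complex.I_ne_zero) (hc.symm.trans (by simp))
  refine ⟨by simpa [norm_algebraMap'], by simpa [norm_algebraMap'], algebraMap ℂ Sc c,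
    (IsUnit.mk0 c c_ne_zero).map _, ?_, ?_⟩
  · rw [norm_algebraMap']
    exact lt_of_pow_lt_pow_left₀ 4 ((abs_nonneg s).trans hs.le) norm_c
  · rw [← map_pow, hc]
    ext
    · simp [TrivSqZeroExt.algebraMap_eq_inl']
      field_simp
    · simp [TrivSqZeroExt.algebraMap_eq_inl']

lemma exists_linked (hr : 0 < r) : ∃ T : Sc, IsUnit T ∧ star T = T ∧ Linked r 0 T ∧
    Linked r 0 (2 * T) ∧ Linked r T (2 * T) := by
  obtain ⟨t, ht, hlt⟩ := exists_between (lt_min (half_pos hr) (pow_pos hr 4))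
  obtain ⟨htr, htr4⟩ := lt_min_iff.1 hlt
  have link {s s' : ℝ} (hs : s ∈ Set.Icc 0 (2 * t)) (hs' : s' ∈ Set.Icc 0 (2 * t))
      (hne : s ≠ s') : Linked r (algebraMap ℝ Sc s) (algebraMap ℝ Sc s') := by
    obtain ⟨h₀, h₁⟩ := hs
    obtain ⟨h₀', h₁'⟩ := hs'
    refine linked_algebraMap hne ?_ ?_ ?_ <;> rw [abs_lt] <;> constructor <;> linarith
  have T_two : 2 * algebraMap ℝ Sc t = algebraMap ℝ Sc (2 * t) := by rw [map_mul, map_ofNat]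
  have zero_eq : (0 : Sc) = algebraMap ℝ Sc 0 := (map_zero _).symm
  refine ⟨algebraMap ℝ Sc t, (IsUnit.mk0 t ht.ne').map _, ?_, ?_, ?_, ?_⟩
  · rw [← algebraMap_star_comm, star_trivial]
  · rw [zero_eq]
    exact link ⟨by simp, by linarith⟩ ⟨by linarith, by linarith⟩ ht.ne
  · rw [zero_eq, T_two]
    exact link ⟨by simp, by linarith⟩ ⟨by linarith, le_rfl⟩ (by linarith)
  · rw [T_two]
    exact link ⟨by linarith, by linarith⟩ ⟨by linarith, le_rfl⟩ (by linarith)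

end Linked

section Parameters

variable {f : Sc × Sc → Sc × Sc} {r : ℝ} {g a : Sc → Sc} {q : Sc → ℂ}

lemma IsPolarizedTangent.mono (h : IsPolarizedTangent f r) {s : ℝ} (hs : 0 < s) (hsr : s ≤ r) :
    IsPolarizedTangent f s where
  pos := hs
  differentiableAt z w hz hw := h.differentiableAt z w (hz.trans_le hsr) (hw.trans_le hsr)
  eqn z ζ w ω hz hζ hw hω := h.eqn z ζ w ω (hz.trans_le hsr) (hζ.trans_le hsr)
    (hw.trans_le hsr) (hω.trans_le hsr)

/-- The polarized equation does not see `g w - g ω` when `v` is replaced by `z = v (1 + τ n)`,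
`ζ = v (1 - τ n)`, for which `z² ζ² = v⁴`. -/
lemma IsPolarizedTangent.linked_coeff_eq (h : IsPolarizedTangent f r)
    (hf : ∀ z w, ‖z‖ < r → ‖w‖ < r → f (z, w) = (z * a w + mkSc 0 (z.snd * q w), g w))
    {w ω : Sc} (hwω : Linked r w ω) : q w = star (q (star ω)) := by
  obtain ⟨hw, hω, v, hv, hvr, eqn_v⟩ := hwω
  have hω' : ‖star ω‖ < r := by rwa [norm_star]
  have snd_eqn (z ζ : Sc) (hz : ‖z‖ < r) (hζ : ‖ζ‖ < r) (hzζ : z ^ 2 * ζ ^ 2 = v ^ 4) :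
      (f (0, w)).2 - (f (0, ω)).2 = 4 * iS * (v ^ 4 * (a w + star (a (star ω))) +
        mkSc 0 (z.fst * ζ.fst ^ 2 * z.snd * q w +
          z.fst ^ 2 * ζ.fst * ζ.snd * star (q (star ω)))) := by
    rw [h.eqn' hz hζ hw hω (by rw [eqn_v, hzζ]), hf z w hz hw,
      hf (star ζ) (star ω) (by rwa [norm_star]) hω', ← hzζ]
    congr 1
    ext <;> simp [sq] <;> ring
  have small : ∀ᶠ τ : ℂ in 𝓝[≠] 0, ‖v * (1 + τ • ε)‖ < r ∧ ‖v * (1 - τ • ε)‖ < r := by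
    refine Filter.Eventually.filter_mono nhdsWithin_le_nhds (Filter.Eventually.and ?_ ?_) <;>
      refine Tendsto.eventually_lt_const hvr (Continuous.tendsto' (by fun_prop) _ _ (by simp))
  obtain ⟨τ, ⟨hz, hζ⟩, hτ⟩ := (small.and eventually_mem_nhdsWithin).exists
  have hzζ : (v * (1 + τ • ε)) ^ 2 * (v * (1 - τ • ε)) ^ 2 = v ^ 4 := by
    have sq_eq_zero : (τ • (ε : Sc)) ^ 2 = 0 := by rw [smul_pow, DualNumber.eps_pow_two, smul_zero]
    linear_combination v ^ 4 * ((τ • ε) ^ 2 - 2) * sq_eq_zero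
  have isUnit_four_iS : IsUnit (4 * iS) := isUnit_iff_fst_ne_zero.2 (by simp)
  have eqn := isUnit_four_iS.mul_left_cancel <|
    (snd_eqn v v hvr hvr (by ring)).symm.trans (snd_eqn _ _ hz hζ hzζ)
  have key : τ * v.fst ^ 4 * (q w - star (q (star ω))) = 0 := by
    have snd_eqn := congrArg TrivSqZeroExt.snd eqn
    simp only [TrivSqZeroExt.snd_add, TrivSqZeroExt.snd_sub, TrivSqZeroExt.snd_mul,
      TrivSqZeroExt.snd_one, TrivSqZeroExt.snd_smul, TrivSqZeroExt.fst_add, TrivSqZeroExt.fst_sub,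
      TrivSqZeroExt.fst_mul, TrivSqZeroExt.fst_one, TrivSqZeroExt.fst_smul, DualNumber.fst_eps,
      DualNumber.snd_eps, MulOpposite.smul_eq_mul_unop, MulOpposite.unop_op, smul_eq_mul, snd_mkSc,
      mul_zero, mul_one, add_zero, zero_add, sub_zero, zero_sub, mul_neg, add_right_inj] at snd_eqn
    linear_combination -snd_eqn
  have v_ne_zero := isUnit_iff_fst_ne_zero.1 hv
  exact sub_eq_zero.1 ((mul_eq_zero.1 key).resolve_left (mul_ne_zero hτ (pow_ne_zero 4 v_ne_zero)))

lemma exists_real_eventually_eq (hr : 0 < r) (hq : ∀ w ω, Linked r w ω → q w = star (q (star ω))) :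
    ∃ κ : ℝ, ∀ᶠ w in 𝓝 0, q w = κ := by
  obtain ⟨T, -, star_T, link₁, link₂, link₁₂⟩ := exists_linked hr
  have q_T : q T = q 0 := by
    rw [hq _ _ link₁₂, ← hq _ _ link₂]
  have q_zero : star (q 0) = q 0 := by
    conv_rhs => rw [hq 0 T link₁, star_T, q_T]
  refine ⟨(q 0).re, link₁.eventually.mono fun w hw => ?_⟩
  rw [hq w T hw, star_T, q_T, q_zero]
  exact (Complex.conj_eq_iff_re.1 q_zero).symm

lemma coeff_sub_star_eq_of_linked
    (hg : ∀ w ω, Linked r w ω → g w - g ω = 2 * (w - ω) * (a w + star (a (star ω))))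
    {w ω : Sc} (h : Linked r w ω) : a w - star (a (star w)) = a ω - star (a (star ω)) := by
  refine (isUnit_two.mul h.isUnit_sub).mul_left_cancel ?_
  linear_combination -hg w ω h - hg ω w h.symm

lemma eq_affine_of_sub_eq {s : Sc → Sc} {T w β : Sc} (hT : IsUnit T)
    (hβ : s (2 * T) - s T = T * β) (h₁ : g w - g T = 2 * (w - T) * (s w + s T))
    (h₂ : g (2 * T) - g w = 2 * (2 * T - w) * (s (2 * T) + s w))
    (h₁₂ : g T - g (2 * T) = 2 * (T - 2 * T) * (s T + s (2 * T))) :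
    s w = 2 * s T - s (2 * T) + β * w := by
  refine (isUnit_two.mul hT).mul_left_cancel ?_
  linear_combination -h₁ - h₁₂ - h₂ + 2 * w * hβ

lemma exists_half_sub_star_of_linked {T : Sc} (star_T : star T = T)
    (hg : ∀ w ω, Linked r w ω → g w - g ω = 2 * (w - ω) * (a w + star (a (star ω)))) :
    ∃ θ, star θ = -θ ∧ ∀ w, w = T ∨ Linked r w T → star (a (star w)) = a w - 2 * θ := by
  obtain ⟨θ, hθ⟩ : 2 ∣ a T - star (a T) := isUnit_two.dvd
  refine ⟨θ, ?_, ?_⟩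
  · refine isUnit_two.mul_left_cancel ?_
    have := congrArg star hθ
    rw [star_sub, star_star, star_mul, star_ofNat] at this
    linear_combination -this - hθ
  · rintro w (rfl | h)
    · rw [star_T]
      linear_combination -hθ
    · have := coeff_sub_star_eq_of_linked hg h
      rw [star_T, hθ] at this
      linear_combination -this

lemma exists_affine_of_sub_eq {s : Sc → Sc} {T : Sc} (hT : IsUnit T) (star_T : star T = T)
    (link₁ : Linked r 0 T) (link₂ : Linked r 0 (2 * T)) (link₁₂ : Linked r T (2 * T))
    (star_s : ∀ w, star w = w → w = T ∨ Linked r w T → star (s w) = s w)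
    (g_sub : ∀ w ω, Linked r w ω → ω = T ∨ Linked r ω T →
      g w - g ω = 2 * (w - ω) * (s w + s ω)) :
    ∃ β, star β = β ∧ ∀ᶠ w in 𝓝 0,
      s w = s 0 + β * w ∧ g w = g 0 + 4 * s 0 * w + 2 * β * w ^ 2 := by
  have star_two_T : star (2 * T) = 2 * T := by rw [star_mul, star_T, star_ofNat, mul_comm]
  obtain ⟨β, hβ⟩ : T ∣ s (2 * T) - s T := hT.dvd
  have s_eq : ∀ᶠ w in 𝓝 0, Linked r w T ∧ s w = 2 * s T - s (2 * T) + β * w := by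
    filter_upwards [link₁.eventually, link₂.eventually] with w hw₁ hw₂
    exact ⟨hw₁, eq_affine_of_sub_eq hT hβ (g_sub w T hw₁ (.inl rfl))
      (g_sub (2 * T) w hw₂.symm (.inr hw₁)) (g_sub T (2 * T) link₁₂ (.inr link₁₂.symm))⟩
  refine ⟨β, ?_, s_eq.mono fun w ⟨hw, sw⟩ => ?_⟩
  · refine hT.mul_left_cancel ?_
    have := congrArg star hβ
    rw [star_sub, star_s _ star_two_T (.inr link₁₂.symm), star_s _ star_T (.inl rfl), star_mul,
      star_T] at this
    linear_combination hβ - this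
  · have s₀ := s_eq.self_of_nhds.2
    have sw' : s w = s 0 + β * w := by linear_combination sw - s₀
    refine ⟨sw', ?_⟩
    linear_combination g_sub w T hw (.inl rfl) - g_sub 0 T link₁ (.inl rfl) +
      2 * (w - T) * sw' - 2 * w * (s₀ - hβ)

/-- Up to an additive constant, `a` is its own conjugate `w ↦ star (a (star w))`, so that
`(w - ω) (s w + s ω)` is a coboundary, where `s` is the real part of `a`. -/
lemma exists_affine_of_linked (hr : 0 < r) (g_zero : star (g 0) = g 0)
    (hg : ∀ w ω, Linked r w ω → g w - g ω = 2 * (w - ω) * (a w + star (a (star ω)))) :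
    ∃ c : S × Sc × S, ∀ᶠ w in 𝓝 0, ∀ z, (z * a w, g w) = sField c (z, w) := by
  obtain ⟨T, isUnit_T, star_T, link₁, link₂, link₁₂⟩ := exists_linked hr
  obtain ⟨θ, star_θ, star_a⟩ := exists_half_sub_star_of_linked star_T hg
  let s : Sc → Sc := fun w => a w - θ
  have g_sub (w ω : Sc) (h : Linked r w ω) (hω : ω = T ∨ Linked r ω T) :
      g w - g ω = 2 * (w - ω) * (s w + s ω) := by
    rw [hg w ω h, star_a ω hω]
    ring
  have star_s (w : Sc) (star_w : star w = w) (hw : w = T ∨ Linked r w T) :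
      star (s w) = s w := by
    have := star_a w hw
    rw [star_w] at this
    rw [star_sub, this, star_θ]
    ring
  obtain ⟨β, star_β, affine⟩ :=
    exists_affine_of_sub_eq isUnit_T star_T link₁ link₂ link₁₂ star_s g_sub
  obtain ⟨A, hA⟩ := exists_ofS_eq g_zero
  obtain ⟨C, hC⟩ := exists_ofS_eq star_β
  refine ⟨(A, s 0 + θ, C), affine.mono fun w ⟨s_eq, g_eq⟩ z => ?_⟩
  have star_s₀ : star (s 0) = s 0 := star_s 0 (star_zero _) (.inr link₁)
  ext1
  · rw [sField_apply, hC, quadField]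
    linear_combination z * s_eq
  · simp only [sField_apply, quadField, hA, hC, star_add, star_s₀, star_θ]
    linear_combination g_eq

end Parameters

section Classification

variable {X : Germ (𝓝 (0 : Sc × Sc)) (Sc × Sc)}

lemma exists_isPolarizedTangent_of_mem_aut (hX : X ∈ aut rho) :
    ∃ f r, X = germ f ∧ IsPolarizedTangent f r := by
  obtain ⟨f, rfl, hf, ht⟩ := hX
  obtain ⟨r, hr⟩ := exists_isPolarizedTangent hf ht
  exact ⟨f, r, rfl, hr⟩

lemma exists_eq_germ_sField {g a : Sc → Sc}
    (h : germ (fun p => (p.1 * a p.2, g p.2)) ∈ aut rho) :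
    ∃ c, germ (fun p => (p.1 * a p.2, g p.2)) = germ (sField c) := by
  obtain ⟨f, r₁, hf, tangent⟩ := exists_isPolarizedTangent_of_mem_aut h
  obtain ⟨r₂, hr₂, f_eq⟩ := Metric.eventually_nhds_iff_ball.1 (Germ.coe_eq.1 hf)
  let r := min r₁ r₂
  have hr : 0 < r := lt_min tangent.pos hr₂
  have tangent' : IsPolarizedTangent f r := tangent.mono hr (min_le_left _ _)
  replace f_eq (z w : Sc) (hz : ‖z‖ < r) (hw : ‖w‖ < r) : f (z, w) = (z * a w, g w) := by
    refine (f_eq (z, w) ?_).symm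
    rw [mem_ball_zero_iff, Prod.norm_mk]
    exact (max_lt hz hw).trans_le (min_le_right _ _)
  have norm_zero_lt : ‖(0 : Sc)‖ < r := by rwa [norm_zero]
  have g_zero : star (g 0) = g 0 := by
    have := tangent'.snd_eq_star norm_zero_lt norm_zero_lt
    rw [star_zero, f_eq 0 0 norm_zero_lt norm_zero_lt] at this
    exact this.symm
  obtain ⟨c, hc⟩ := exists_affine_of_linked (a := a) hr g_zero fun w ω hwω => by
    obtain ⟨hw, hω, v, -, hv, hwω⟩ := hwω
    have := tangent'.eqn' hv hv hw hω (by rw [hwω]; ring)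
    rw [f_eq 0 w norm_zero_lt hw, f_eq 0 ω norm_zero_lt hω, f_eq v w hv hw,
      f_eq (star v) (star ω) (by rwa [norm_star]) (by rwa [norm_star])] at this
    rw [this, hwω, star_mul, star_star]
    ring
  exact ⟨c, Germ.coe_eq.2 ((continuous_snd.tendsto' 0 0 rfl).eventually hc |>.mono
    fun p hp => hp p.1)⟩

lemma exists_real_sub_smul_X0_eq (hX : X ∈ aut rho) : ∃ (κ : ℝ) (g a : Sc → Sc),
    X - κ • germ X0 = germ fun p => (p.1 * a p.2, g p.2) := by
  obtain ⟨f, r, rfl, tangent⟩ := exists_isPolarizedTangent_of_mem_aut hX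
  obtain ⟨g, a, q, f_eq⟩ := tangent.exists_normalForm
  obtain ⟨κ, hκ⟩ := exists_real_eventually_eq tangent.pos fun w ω =>
    tangent.linked_coeff_eq f_eq
  refine ⟨κ, fun w => g w - κ • mkSc 0 w.snd, a, Germ.coe_eq.2 ?_⟩
  filter_upwards [(continuous_snd.tendsto' 0 0 rfl).eventually hκ,
    Metric.ball_mem_nhds 0 tangent.pos] with p hp hpr
  rw [mem_ball_zero_iff, Prod.norm_def, max_lt_iff] at hpr
  have smul_X0 : κ • X0 p = (mkSc 0 (p.1.snd * κ), κ • mkSc 0 p.2.snd) := by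
    ext <;> simp [X0, mul_comm]
  change f p - κ • X0 p = _
  rw [f_eq p.1 p.2 hpr.1 hpr.2, hp, smul_X0, Prod.mk_sub_mk, add_sub_cancel_right]

theorem mem_aut_iff : X ∈ aut rho ↔ ∃ c, ∃ κ : ℝ, X = germ (sField c) + κ • germ X0 := by
  constructor
  · intro hX
    obtain ⟨κ, g, a, h⟩ := exists_real_sub_smul_X0_eq hX
    obtain ⟨c, hc⟩ := exists_eq_germ_sField (h ▸ sub_mem hX ((aut rho).smul_mem κ X0_mem_aut))
    exact ⟨c, κ, by rw [← hc, ← h, sub_add_cancel]⟩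
  · rintro ⟨c, κ, rfl⟩
    exact add_mem (sField_mem_aut c) ((aut rho).smul_mem κ X0_mem_aut)

theorem mem_autS_iff : X ∈ autS ↔ ∃ c, X = germ (sField c) := by
  constructor
  · intro hX
    obtain ⟨c, κ, rfl⟩ := mem_aut_iff.1 hX.1
    have smul_mem : κ • germ X0 ∈ autS := by
      simpa using autS.sub_mem hX (sField_mem_autS c)
    exact ⟨c, by rw [eq_zero_of_smul_X0_mem_autS smul_mem, zero_smul, add_zero]⟩
  · rintro ⟨c, rfl⟩
    exact sField_mem_autS c

theorem autS_sup_span_X0 : autS ⊔ Submodule.span ℝ {germ X0} = aut rho := by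
  ext X
  simp [Submodule.mem_sup, Submodule.mem_span_singleton, mem_autS_iff, mem_aut_iff,
    eq_comm (b := X)]

instance : FiniteDimensional ℝ autS := by
  have finite_dualNumber (K : Type) [AddCommGroup K] [Module ℝ K] [FiniteDimensional ℝ K] :
      FiniteDimensional ℝ (TrivSqZeroExt K K) := inferInstanceAs (FiniteDimensional ℝ (K × K))
  let germ_sField : S × Sc × S →ₗ[ℝ] Germ (𝓝 (0 : Sc × Sc)) (Sc × Sc) :=
    { toFun c := germ (sField c)
      map_add' c d := by
        rw [map_add]
        rfl
      map_smul' t c := by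
        rw [map_smul]
        rfl }
  have autS_eq : autS = LinearMap.range germ_sField := by
    ext X
    exact mem_autS_iff.trans (exists_congr fun c => eq_comm)
  rw [autS_eq]
  infer_instance

theorem finiteDimensional_aut : FiniteDimensional ℝ (aut rho) := by
  rw [← autS_sup_span_X0]
  infer_instance

theorem finrank_aut : Module.finrank ℝ (aut rho) = Module.finrank ℝ autS + 1 := by
  have h := Submodule.finrank_sup_add_finrank_inf_eq autS (Submodule.span ℝ {germ X0})
  rwa [autS_sup_span_X0, autS_inf_span_X0, finrank_bot, add_zero,
    finrank_span_singleton germ_X0_ne_zero] at h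

end Classification

section BinomialSeries

lemma mem_eball_one {A : Type*} [SeminormedAddCommGroup A] {y : A}
    (hy : ‖y‖ < 1) : y ∈ Metric.eball (0 : A) 1 := by
  rw [← ENNReal.ofReal_one, Metric.eball_ofReal]
  simpa

variable {𝕂 A : Type*} [RCLike 𝕂] [NormedCommRing A] [NormedAlgebra 𝕂 A] [NormOneClass A] {y : A}

lemma one_le_radius_binomialSeries (a : 𝕂) : 1 ≤ (binomialSeries A a).radius := by
  refine (binomialSeries_radius_ge_one (𝔸 := 𝕂) (a := a)).trans
    (FormalMultilinearSeries.radius_le_of_le fun n => ?_)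
  simp only [binomialSeries, FormalMultilinearSeries.ofScalars_norm, le_refl]

variable [CompleteSpace A]

lemma hasFPowerSeriesOnBall_binomialSeries_sum (a : 𝕂) :
    HasFPowerSeriesOnBall (binomialSeries A a).sum (binomialSeries A a) 0 1 :=
  ((binomialSeries A a).hasFPowerSeriesOnBall
    (one_pos.trans_le (one_le_radius_binomialSeries a))).mono one_pos
    (one_le_radius_binomialSeries a)

lemma hasSum_binomialSeries (a : 𝕂) (hy : ‖y‖ < 1) :
    HasSum (fun k => Ring.choose a k • y ^ k) ((binomialSeries A a).sum y) := by
  simpa [List.ofFn_const] using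
    (hasFPowerSeriesOnBall_binomialSeries_sum a).hasSum (mem_eball_one hy)

lemma differentiableAt_binomialSeries_sum (a : 𝕂) (hy : ‖y‖ < 1) :
    DifferentiableAt 𝕂 (binomialSeries A a).sum y :=
  ((hasFPowerSeriesOnBall_binomialSeries_sum a).analyticAt_of_mem
    (mem_eball_one hy)).differentiableAt

lemma binomialSeries_sum_add (a b : 𝕂) (hy : ‖y‖ < 1) : (binomialSeries A (a + b)).sum y =
    (binomialSeries A a).sum y * (binomialSeries A b).sum y := by
  have summable_norm (a : 𝕂) : Summable fun k => ‖Ring.choose a k • y ^ k‖ := by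
    simpa [List.ofFn_const] using (binomialSeries A a).summable_norm_apply
      (Metric.eball_subset_eball (one_le_radius_binomialSeries a) (mem_eball_one hy))
  rw [← (hasSum_binomialSeries a hy).tsum_eq, ← (hasSum_binomialSeries b hy).tsum_eq,
    tsum_mul_tsum_eq_tsum_sum_antidiagonal_of_summable_norm (summable_norm a) (summable_norm b),
    ← (hasSum_binomialSeries (a + b) hy).tsum_eq]
  refine tsum_congr fun n => ?_
  rw [Ring.add_choose_eq n (Commute.all a b), Finset.sum_smul]
  refine Finset.sum_congr rfl fun ij hij => ?_
  rw [smul_mul_smul_comm, ← pow_add, Finset.HasAntidiagonal.mem_antidiagonal.1 hij]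

lemma binomialSeries_sum_neg_one_mul (hy : ‖y‖ < 1) :
    (binomialSeries A (-1 : 𝕂)).sum y * (1 + y) = 1 := by
  have choose_neg_one (k : ℕ) : Ring.choose (-1 : 𝕂) k = (-1) ^ k := by
    rw [Ring.choose_neg, add_sub_cancel_left, Ring.choose_natCast, Nat.choose_self]
    simp [Int.negOnePow_def, Units.smul_def]
  rw [← (hasSum_binomialSeries (-1 : 𝕂) hy).tsum_eq]
  have := geom_series_mul_neg (-y) (by rwa [norm_neg])
  simpa only [choose_neg_one, sub_neg_eq_add, neg_pow y, Algebra.smul_def, map_pow, map_neg,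
    map_one] using this

end BinomialSeries

section InvSqrt

/-- The power `(1 + y) ^ (-1 / 2)` in `Sc`, as the sum of the binomial series. -/
def invSqrt (y : Sc) : Sc := (binomialSeries Sc (-1 / 2 : ℂ)).sum y

variable {y : Sc}

lemma invSqrt_sq (hy : ‖y‖ < 1) : invSqrt y ^ 2 = (binomialSeries Sc (-1 : ℂ)).sum y := by
  rw [show (-1 : ℂ) = -1 / 2 + -1 / 2 by norm_num, binomialSeries_sum_add _ _ hy, sq, invSqrt]

lemma invSqrt_sq_mul (hy : ‖y‖ < 1) : invSqrt y ^ 2 * (1 + y) = 1 := by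
  rw [invSqrt_sq hy, binomialSeries_sum_neg_one_mul hy]

lemma inv_one_add (hy : ‖y‖ < 1) : (1 + y)⁻¹ = invSqrt y ^ 2 := by
  have ne_zero : (1 + y).fst ≠ 0 :=
    isUnit_iff_fst_ne_zero.1 (IsUnit.of_mul_eq_one_right _ (invSqrt_sq_mul hy))
  have inv_mul := TrivSqZeroExt.inv_mul_cancel ne_zero
  linear_combination invSqrt y ^ 2 * inv_mul - (1 + y)⁻¹ * invSqrt_sq_mul hy

lemma invSqrt_zero : invSqrt 0 = 1 := by
  refine (hasSum_binomialSeries (-1 / 2 : ℂ) (y := (0 : Sc)) (by simp)).unique ?_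
  convert hasSum_single 0 fun k hk => ?_ using 1
  · simp
  · simp [hk]

lemma exists_hasFDerivAt_invSqrt (hy : ‖y‖ < 1) : ∃ L : Sc →L[ℝ] Sc,
    HasFDerivAt invSqrt L y ∧ ∀ v, 2 * L v = -(invSqrt y ^ 3 * v) := by
  have h : HasFDerivAt invSqrt (fderiv ℝ invSqrt y) y :=
    ((differentiableAt_binomialSeries_sum (-1 / 2 : ℂ) hy).restrictScalars ℝ).hasFDerivAt
  refine ⟨_, h, fun v => ?_⟩
  have eventually_one : (fun x => invSqrt x ^ 2 * (1 + x)) =ᶠ[𝓝 y] fun _ => 1 := by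
    filter_upwards [continuous_norm.continuousAt.eventually_lt_const hy] with x hx
    exact invSqrt_sq_mul hx
  have derivative := DFunLike.congr_fun ((((h.pow 2).mul ((hasFDerivAt_id y).const_add 1)
    ).congr_of_eventuallyEq eventually_one.symm).unique (hasFDerivAt_const 1 y)) v
  simp only [id_eq, Nat.add_one_sub_one, pow_one, nsmul_eq_mul, Nat.cast_ofNat, add_apply,
    smul_apply, ContinuousLinearMap.id_apply, smul_eq_mul, zero_apply] at derivative
  linear_combination invSqrt y * derivative - 2 * fderiv ℝ invSqrt y v * invSqrt_sq_mul hy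

end InvSqrt

section TimeOneMap

variable {E : Type*} [NormedAddCommGroup E] [NormedSpace ℝ E]

lemma eqOn_Icc_of_isIntegralCurveOn {f : E → E} (hf : LocallyLipschitz f) {γ δ : ℝ → E} {a b : ℝ}
    (hγ : IsIntegralCurveOn γ (fun _ => f) (Set.Icc a b))
    (hδ : IsIntegralCurveOn δ (fun _ => f) (Set.Icc a b)) (h : γ a = δ a) :
    Set.EqOn γ δ (Set.Icc a b) := by
  have isCompact_images : IsCompact (γ '' Set.Icc a b ∪ δ '' Set.Icc a b) :=
    (isCompact_Icc.image_of_continuousOn hγ.continuousOn).union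
      (isCompact_Icc.image_of_continuousOn hδ.continuousOn)
  obtain ⟨K, hK⟩ := (hf.locallyLipschitzOn (s := γ '' Set.Icc a b ∪ δ '' Set.Icc a b)
    ).exists_lipschitzOnWith_of_compact isCompact_images
  have Icc_mem_nhdsGE {t : ℝ} (ht : t ∈ Set.Ico a b) : Set.Icc a b ∈ 𝓝[≥] t :=
    mem_of_superset (Icc_mem_nhdsGE ht.2) (Set.Icc_subset_Icc_left ht.1)
  exact ODE_solution_unique_of_mem_Icc_right (v := fun _ => f)
    (s := fun _ => γ '' Set.Icc a b ∪ δ '' Set.Icc a b) (fun _ _ => hK) hγ.continuousOn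
    (fun t ht => (hγ t (Set.Ico_subset_Icc_self ht)).mono_of_mem_nhdsWithin (Icc_mem_nhdsGE ht))
    (fun t ht => .inl ⟨t, Set.Ico_subset_Icc_self ht, rfl⟩) hδ.continuousOn
    (fun t ht => (hδ t (Set.Ico_subset_Icc_self ht)).mono_of_mem_nhdsWithin (Icc_mem_nhdsGE ht))
    (fun t ht => .inr ⟨t, Set.Ico_subset_Icc_self ht, rfl⟩) h

/-- Near the origin `h` is the time-one map of the flow of `f`. Unlike `IsExp`, this concerns a
globally defined field and does not confine the integral curves. -/
def IsTimeOneMap (f h : E → E) : Prop :=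
  ∀ᶠ p in 𝓝 (0 : E), ∃ γ : ℝ → E, γ 0 = p ∧ γ 1 = h p ∧
    IsIntegralCurveOn γ (fun _ => f) (Set.Icc 0 1)

variable {f h h' : E → E}

lemma IsTimeOneMap.eventuallyEq (hf : LocallyLipschitz f) (h₁ : IsTimeOneMap f h)
    (h₂ : IsTimeOneMap f h') : h =ᶠ[𝓝 0] h' := by
  filter_upwards [h₁, h₂] with p ⟨γ, γ_zero, γ_one, hγ⟩ ⟨δ, δ_zero, δ_one, hδ⟩
  rw [← γ_one, ← δ_one]
  exact eqOn_Icc_of_isIntegralCurveOn hf hγ hδ (γ_zero.trans δ_zero.symm)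
    (Set.right_mem_Icc.2 zero_le_one)

variable [NormedSpace ℂ E]

lemma IsTimeOneMap.isExp (hf : AnalyticOnNhd ℂ f Set.univ) (h₁ : IsTimeOneMap f h) :
    IsExp (f : Germ (𝓝 (0 : E)) E) h := by
  refine ⟨Set.univ, f, h, isOpen_univ, isConnected_univ, trivial, hf, rfl, rfl, ?_⟩
  filter_upwards [h₁] with p ⟨γ, γ_zero, γ_one, hγ⟩
  exact ⟨γ, γ_zero, γ_one, fun t ht => ⟨trivial, hγ t ht⟩⟩

/-- By the identity theorem, any field representing the germ of `f` agrees with `f` on its whole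
connected domain. -/
lemma IsExp.exists_isTimeOneMap (hf : AnalyticOnNhd ℂ f Set.univ) {H : Germ (𝓝 (0 : E)) E}
    (h₁ : IsExp (f : Germ (𝓝 (0 : E)) E) H) :
    ∃ h : E → E, H = (h : Germ (𝓝 (0 : E)) E) ∧ IsTimeOneMap f h := by
  obtain ⟨U, g, h, -, connected, zero_mem, hg, germ_eq, rfl, curves⟩ := h₁
  have eqOn := (hf.mono (Set.subset_univ U)).eqOn_of_preconnected_of_eventuallyEq hg
    connected.isPreconnected zero_mem (Germ.coe_eq.1 germ_eq)
  refine ⟨h, rfl, ?_⟩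
  filter_upwards [curves] with p ⟨γ, γ_zero, γ_one, hγ⟩
  refine ⟨γ, γ_zero, γ_one, fun t ht => ?_⟩
  simpa only [eqOn (hγ t ht).1] using (hγ t ht).2

end TimeOneMap

section CompMap

/-- The map `GNeg a ∘ GZero b ∘ GPos e` with parameters `q = (a, b, e)`, near the origin and for
arbitrary `a` and `e` in `Sc`. -/
def compMap (q : Sc × Sc × Sc) (p : Sc × Sc) : Sc × Sc :=
  (q.2.1 * (p.1 * invSqrt (-(q.2.2 * p.2))),
    q.2.1 ^ 2 * star q.2.1 ^ 2 * (p.2 * invSqrt (-(q.2.2 * p.2)) ^ 2) + q.1)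

lemma compMap_apply_zero_right (q : Sc × Sc × Sc) (Z : Sc) :
    compMap q (Z, 0) = (q.2.1 * Z, q.1) := by
  simp [compMap, invSqrt_zero]

lemma compMap_zero_one_zero (p : Sc × Sc) : compMap (0, 1, 0) p = p := by
  simp [compMap, invSqrt_zero]

lemma compMap_ofS (A C : S) (B : Sc) {p : Sc × Sc} (hp : ‖-(ofS C * p.2)‖ < 1) :
    compMap (ofS A, B, ofS C) p = (GNeg A ∘ GZero B ∘ GPos C) p := by
  simp only [compMap, Function.comp_apply, GPos, GZero, GNeg, invSqrt, star_eq_conjS,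
    sub_eq_add_neg, inv_one_add hp]

lemma eventually_norm_neg_mul_snd_lt_one (e : Sc) :
    ∀ᶠ p in 𝓝 (0 : Sc × Sc), ‖-(e * p.2)‖ < 1 :=
  (Continuous.tendsto' (by fun_prop) 0 0 (by simp)).eventually_lt_const one_pos

lemma germ_compMap_ofS (A C : S) (B : Sc) :
    germ (compMap (ofS A, B, ofS C)) = germ (GNeg A ∘ GZero B ∘ GPos C) := by
  refine Germ.coe_eq.2 ?_
  filter_upwards [eventually_norm_neg_mul_snd_lt_one (ofS C)] with p hp using compMap_ofS A C B hp

lemma sHolFun_monomial_mul_of_hasSum (a : Sc) (j m : ℕ) {d : ℕ → Sc} {v : Sc × Sc → Sc}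
    (h : ∀ᶠ p in 𝓝 (0 : Sc × Sc), HasSum (fun k => d k * p.2 ^ k) (v p)) :
    SHolFun fun p => a * p.1 ^ j * p.2 ^ m * v p := by
  have injective : Function.Injective fun k : ℕ => (j, m + k) := fun k l h => by
    simpa using (Prod.mk.inj h).2
  refine ⟨fun i => if i.1 = j ∧ m ≤ i.2 then a * d (i.2 - m) else 0, ?_⟩
  filter_upwards [h] with p hp
  rw [← injective.hasSum_iff]
  · refine (hp.mul_left (a * p.1 ^ j * p.2 ^ m)).congr_fun fun k => ?_
    simp only [Function.comp_apply, le_add_iff_nonneg_right, zero_le, and_self, ↓reduceIte,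
      add_tsub_cancel_left, pow_add]
    ring
  · rintro ⟨i, l⟩ hil
    have : ¬(i = j ∧ m ≤ l) := by
      rintro ⟨rfl, hl⟩
      exact hil ⟨l - m, by simp [hl]⟩
    simp [this]

lemma sHolFun_monomial_mul_binomialSeries_sum (r : ℂ) (a e : Sc) (j m : ℕ) :
    SHolFun fun p => a * p.1 ^ j * p.2 ^ m * (binomialSeries Sc r).sum (-(e * p.2)) := by
  refine sHolFun_monomial_mul_of_hasSum a j m (d := fun k => Ring.choose r k • (-e) ^ k) ?_
  filter_upwards [eventually_norm_neg_mul_snd_lt_one e] with p hp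
  simpa only [smul_mul_assoc, ← mul_pow, neg_mul] using hasSum_binomialSeries r hp

lemma sHol_compMap (q : Sc × Sc × Sc) : SHol (germ (compMap q)) := by
  rw [sHol_germ_iff]
  constructor
  · refine (sHolFun_monomial_mul_binomialSeries_sum (-1 / 2) q.2.1 q.2.2 1 0).congr
      (.of_forall fun p => ?_)
    simp only [compMap, invSqrt]
    ring
  · refine ((sHolFun_monomial_mul_binomialSeries_sum (-1) (q.2.1 ^ 2 * star q.2.1 ^ 2) q.2.2 0 1
      ).add (sHolFun_monomial q.1 0 0)).congr ?_
    filter_upwards [eventually_norm_neg_mul_snd_lt_one q.2.2] with p hp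
    rw [compMap, invSqrt_sq hp]
    ring

end CompMap

section Flow

/-- The automorphism `z₁ + z₂ n ↦ z₁ + eᵗ z₂ n` of `Sc`, through which `flow t` acts on both
coordinates. -/
def scale (t : ℝ) : Sc →ₐ[ℂ] Sc where
  toFun Z := mkSc Z.fst (Complex.exp t * Z.snd)
  map_one' := by ext <;> simp
  map_mul' Z W := by
    ext
    · simp
    · simp
      ring
  map_zero' := by ext <;> simp
  map_add' Z W := by ext <;> simp [mul_add]
  commutes' c := by ext <;> simp [TrivSqZeroExt.algebraMap_eq_inl]

lemma scale_apply (t : ℝ) (Z : Sc) : scale t Z = mkSc Z.fst (Complex.exp t * Z.snd) := rfl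

lemma flow_apply (t : ℝ) (p : Sc × Sc) : flow t p = (scale t p.1, scale t p.2) := rfl

lemma star_scale (t : ℝ) (Z : Sc) : star (scale t Z) = scale t (star Z) := by
  ext <;> simp [scale_apply, ← Complex.exp_conj]

lemma scale_add (s t : ℝ) (Z : Sc) : scale (s + t) Z = scale s (scale t Z) := by
  ext <;> simp [scale_apply, Complex.exp_add, mul_assoc]

lemma scale_zero (Z : Sc) : scale 0 Z = Z := by ext <;> simp [scale_apply]

lemma flow_zero : flow 0 = id := by
  funext p
  simp only [flow_apply, scale_zero, id]

lemma flow_add (s t : ℝ) : flow (s + t) = flow s ∘ flow t := by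
  funext p
  simp only [flow_apply, scale_add, Function.comp_apply]

lemma flow_quadField (t : ℝ) (a b e : Sc) (p : Sc × Sc) :
    flow t (quadField a b e p) = quadField (scale t a) (scale t b) (scale t e) (flow t p) := by
  simp only [flow_apply, quadField, map_add, map_mul, map_pow, map_ofNat, star_scale]

lemma flow_X0 (t : ℝ) (p : Sc × Sc) : flow t (X0 p) = X0 (flow t p) := by
  simp [flow, X0]

lemma hasDerivWithinAt_scale {u : ℝ → Sc} {u' : Sc} {s : Set ℝ} {t : ℝ}
    (hu : HasDerivWithinAt u u' s t) (κ : ℝ) : HasDerivWithinAt (fun t => scale (κ * t) (u t))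
      (scale (κ * t) u' + κ • mkSc 0 (scale (κ * t) (u t)).snd) s t := by
  let N : Sc →L[ℝ] Sc :=
    ((TrivSqZeroExt.inrCLM ℂ ℂ).comp (TrivSqZeroExt.sndCLM ℂ ℂ)).restrictScalars ℝ
  have scale_eq (t : ℝ) (Z : Sc) : scale t Z = Z + (Real.exp t - 1) • N Z := by
    ext <;> simp [scale_apply, N, -DualNumber.inr_eq_smul_eps, sub_mul]
  have exp_deriv :
      HasDerivWithinAt (fun t => Real.exp (κ * t) - 1) (Real.exp (κ * t) * κ) s t := by
    simpa using (((hasDerivAt_id t).const_mul κ).exp.sub_const 1).hasDerivWithinAt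
  simp only [scale_eq]
  refine (hu.add (exp_deriv.smul (N.hasFDerivAt.comp_hasDerivWithinAt t hu))).congr_deriv ?_
  ext
  · simp [N, -DualNumber.inr_eq_smul_eps]
  · simp [N, -DualNumber.inr_eq_smul_eps, -Complex.coe_smul]
    ring

lemma hasDerivWithinAt_flow {γ : ℝ → Sc × Sc} {v : Sc × Sc} {s : Set ℝ} {t : ℝ}
    (hγ : HasDerivWithinAt γ v s t) (κ : ℝ) : HasDerivWithinAt (fun t => flow (κ * t) (γ t))
      (flow (κ * t) v + κ • X0 (flow (κ * t) (γ t))) s t :=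
  (hasDerivWithinAt_scale hγ.fst κ).prodMk (hasDerivWithinAt_scale hγ.snd κ)

lemma hasDerivAt_flow (p : Sc × Sc) (t : ℝ) :
    HasDerivAt (fun s => flow s p) (X0 (flow t p)) t := by
  have flow_zero_right : flow t 0 = 0 := by simp [flow_apply]
  simpa [hasDerivWithinAt_univ, flow_zero_right] using
    hasDerivWithinAt_flow (hasDerivWithinAt_const t Set.univ p) 1

lemma isExp_flow (t : ℝ) : IsExp (t • germ X0) (germ (flow t)) := by
  refine IsTimeOneMap.isExp (f := t • X0) (fun p hp => (analyticOnNhd_X0 p hp).const_smul)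
    (.of_forall fun p => ⟨fun s => flow (s * t) p, ?_, ?_, fun s _ => ?_⟩)
  · simp [flow_zero]
  · simp
  · simpa [Function.comp_def] using
      ((hasDerivAt_flow p (s * t)).scomp s ((hasDerivAt_id s).mul_const t)).hasDerivWithinAt

lemma differentiable_flow (t : ℝ) : Differentiable ℂ (flow t) := by
  have continuous_scale : Continuous (scale t) :=
    (TrivSqZeroExt.continuous_inl.comp TrivSqZeroExt.continuous_fst).add
      (TrivSqZeroExt.continuous_inr.comp (continuous_const.mul TrivSqZeroExt.continuous_snd))
  have differentiable_scale : Differentiable ℂ (scale t) :=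
    (⟨(scale t).toLinearMap, continuous_scale⟩ : Sc →L[ℂ] Sc).differentiable
  exact (differentiable_scale.comp differentiable_fst).prodMk
    (differentiable_scale.comp differentiable_snd)

lemma rho_flow_eq_zero {p : Sc × Sc} (hp : rho p = 0) (t : ℝ) : rho (flow t p) = 0 := by
  rw [rho_eq_zero_iff] at hp ⊢
  have scale_iS : scale t iS = iS := by ext <;> simp [scale_apply]
  simpa only [flow_apply, map_sub, map_mul, map_pow, map_ofNat, star_scale, scale_iS] using
    congrArg (scale t) hp

lemma flow_image_Q (t : ℝ) : flow t '' Q = Q := by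
  apply Set.Subset.antisymm
  · rintro _ ⟨p, hp, rfl⟩
    exact rho_flow_eq_zero hp t
  · intro p hp
    refine ⟨flow (-t) p, rho_flow_eq_zero hp (-t), ?_⟩
    rw [← Function.comp_apply (f := flow t), ← flow_add, add_neg_cancel, flow_zero, id]

end Flow

section ParamField

/-- The field on the space of parameters of `compMap` whose integral curves `q` make
`t ↦ compMap (q t) p` an integral curve of `quadField a b e`. -/
def paramField (a b e : Sc) (q : Sc × Sc × Sc) : Sc × Sc × Sc :=
  (a + 2 * (b + star b) * q.1 + 2 * e * q.1 ^ 2, q.2.1 * (b + e * q.1),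
    2 * e * (q.2.1 * star q.2.1) ^ 2)

lemma isIntegralCurveOn_paramField {a b e A B C : ℝ → Sc} {s : Set ℝ}
    (hA : ∀ t ∈ s, HasDerivWithinAt A
      (a t + 2 * (b t + star (b t)) * A t + 2 * e t * A t ^ 2) s t)
    (hB : ∀ t ∈ s, HasDerivWithinAt B (B t * (b t + e t * A t)) s t)
    (hC : ∀ t ∈ s, HasDerivWithinAt C (2 * e t * (B t * star (B t)) ^ 2) s t) :
    IsIntegralCurveOn (fun t => (A t, B t, C t)) (fun t => paramField (a t) (b t) (e t)) s :=
  fun t ht => (hA t ht).prodMk ((hB t ht).prodMk (hC t ht))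

lemma hasDerivWithinAt_compMap {a b e : Sc} (he : star e = e) {q : ℝ → Sc × Sc × Sc} {s : Set ℝ}
    {t : ℝ} (hq : HasDerivWithinAt q (paramField a b e (q t)) s t)
    (hq₁ : star (q t).1 = (q t).1) {p : Sc × Sc} (hp : ‖-((q t).2.2 * p.2)‖ < 1) :
    HasDerivWithinAt (fun t => compMap (q t) p) (quadField a b e (compMap (q t) p)) s t := by
  obtain ⟨L, hL, two_mul_L⟩ := exists_hasFDerivAt_invSqrt hp
  have deriv_A : HasDerivWithinAt (fun t => (q t).1) _ s t := hq.fst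
  have deriv_B : HasDerivWithinAt (fun t => (q t).2.1) _ s t := hq.snd.fst
  have deriv_C : HasDerivWithinAt (fun t => (q t).2.2) _ s t := hq.snd.snd
  have deriv_invSqrt := hL.comp_hasDerivWithinAt t (deriv_C.mul_const p.2).neg
  have L_eq : L (-(2 * e * ((q t).2.1 * star (q t).2.1) ^ 2 * p.2)) =
      e * ((q t).2.1 * star (q t).2.1) ^ 2 * p.2 * invSqrt (-((q t).2.2 * p.2)) ^ 3 := by
    refine isUnit_two.mul_left_cancel ?_
    rw [two_mul_L]
    ring
  have deriv_fst := deriv_B.mul (deriv_invSqrt.const_mul p.1)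
  have deriv_snd := (((deriv_B.pow 2).mul (deriv_B.star.pow 2)).mul
    ((deriv_invSqrt.pow 2).const_mul p.2)).add deriv_A
  refine (deriv_fst.prodMk deriv_snd).congr_deriv ?_
  simp only [paramField, L_eq, star_mul, star_add, he, hq₁, Function.comp_apply,
    Pi.neg_apply]
  ext1
  · simp only [quadField, compMap]
    ring
  · simp only [Nat.cast_ofNat, Nat.add_one_sub_one, pow_one, Pi.pow_apply, Function.comp_apply,
      Pi.neg_apply, Pi.mul_apply, quadField, compMap]
    ring

lemma eventually_isIntegralCurveOn_compMap {a b e : ℝ → Sc} (he : ∀ t, star (e t) = e t)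
    {q : ℝ → Sc × Sc × Sc} {s : Set ℝ} (hs : IsCompact s)
    (hq : IsIntegralCurveOn q (fun t => paramField (a t) (b t) (e t)) s)
    (hq₁ : ∀ t ∈ s, star (q t).1 = (q t).1) :
    ∀ᶠ p in 𝓝 (0 : Sc × Sc),
      IsIntegralCurveOn (fun t => compMap (q t) p) (fun t => quadField (a t) (b t) (e t)) s := by
  obtain ⟨M, hM⟩ := hs.exists_bound_of_continuousOn hq.continuousOn.snd.snd
  have small : ∀ᶠ p in 𝓝 (0 : Sc × Sc), M * ‖p.2‖ < 1 :=
    (Continuous.tendsto' (by fun_prop) 0 0 (by simp)).eventually_lt_const one_pos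
  filter_upwards [small] with p hp t ht
  refine hasDerivWithinAt_compMap (he t) (hq t ht) (hq₁ t ht) (lt_of_le_of_lt ?_ hp)
  rw [norm_neg]
  exact (norm_mul_le _ _).trans (mul_le_mul_of_nonneg_right (hM t ht) (norm_nonneg _))

lemma exists_hasDerivAt {f : ℝ → Sc} (hf : Continuous f) : ∃ F : ℝ → Sc, F 0 = 0 ∧
    (∀ t, HasDerivAt F (f t) t) ∧ ((∀ t, star (f t) = f t) → ∀ t, star (F t) = F t) := by
  refine ⟨fun t => ∫ x in (0 : ℝ)..t, f x, intervalIntegral.integral_same,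
    fun t => (hf.integral_hasStrictDerivAt 0 t).hasDerivAt, fun star_f t => ?_⟩
  have star_integral := ((starL' ℝ : Sc ≃L[ℝ] Sc) : Sc →L[ℝ] Sc).intervalIntegral_comp_comm
    (hf.intervalIntegrable (μ := MeasureTheory.volume) 0 t)
  simp only [ContinuousLinearEquiv.coe_coe, starL'_apply, star_f] at star_integral
  exact star_integral.symm

lemma exists_hasDerivAt_mul {f : ℝ → Sc} (hf : Continuous f) : ∃ b : ℝ → Sc, b 0 = 1 ∧
    (∀ t, HasDerivAt b (b t * f t) t) ∧ ∀ t, IsUnit (b t) := by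
  obtain ⟨F, F_zero, hF, -⟩ := exists_hasDerivAt hf
  refine ⟨fun t => NormedSpace.exp (F t), by simp [F_zero], fun t => ?_,
    fun t => NormedSpace.isUnit_exp _⟩
  exact ((hasFDerivAt_exp (𝕂 := ℝ) (x := F t)).comp_hasDerivAt t (hF t)).congr_deriv (by simp)

/-- The field `paramField` is triangular: a solution `ω` of the Riccati equation of the first
parameter determines the other two by quadratures. -/
lemma exists_isIntegralCurveOn_paramField {a b e ω : ℝ → Sc} (hb : Continuous b)
    (he : Continuous e) (star_e : ∀ t, star (e t) = e t) {t₁ : ℝ} (ht₁ : 0 ≤ t₁)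
    (hω : IsIntegralCurveOn ω
      (fun t w => a t + 2 * (b t + star (b t)) * w + 2 * e t * w ^ 2) (Set.Icc 0 t₁)) :
    ∃ q : ℝ → Sc × Sc × Sc, q 0 = (ω 0, 1, 0) ∧
      IsIntegralCurveOn q (fun t => paramField (a t) (b t) (e t)) (Set.Icc 0 t₁) ∧
      (∀ t, (q t).1 = ω t) ∧ ∀ t, IsUnit (q t).2.1 ∧ star (q t).2.2 = (q t).2.2 := by
  obtain ⟨ω', continuous_ω', eqOn⟩ : ∃ ω' : ℝ → Sc, Continuous ω' ∧
      Set.EqOn ω' ω (Set.Icc 0 t₁) :=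
    ⟨_, hω.continuousOn.domRestrict.Icc_extend' (h := ht₁),
      fun t ht => Set.IccExtend_of_mem _ _ ht⟩
  obtain ⟨B, B_zero, hB, isUnit_B⟩ :=
    exists_hasDerivAt_mul (f := fun t => b t + e t * ω' t) (by fun_prop)
  have continuous_B : Continuous B := continuous_iff_continuousAt.2 fun t => (hB t).continuousAt
  obtain ⟨C, C_zero, hC, star_C⟩ :=
    exists_hasDerivAt (f := fun t => 2 * e t * (B t * star (B t)) ^ 2) (by fun_prop)
  refine ⟨fun t => (ω t, B t, C t), by simp only [B_zero, C_zero],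
    isIntegralCurveOn_paramField hω (fun t ht => ?_) fun t _ => (hC t).hasDerivWithinAt,
    fun t => rfl, fun t => ⟨isUnit_B t, star_C (fun t => ?_) t⟩⟩
  · simpa only [eqOn ht] using (hB t).hasDerivWithinAt
  · simp only [star_mul, star_pow, star_star, star_e, star_ofNat]
    ring

end ParamField

section Classification

lemma isIntegralCurveOn_flow {a b e : ℝ → Sc} {μ : ℝ} {γ : ℝ → Sc × Sc} {s : Set ℝ}
    (hγ : IsIntegralCurveOn γ (fun t => quadField (a t) (b t) (e t) + μ • X0) s) (κ : ℝ) :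
    IsIntegralCurveOn (fun t => flow (κ * t) (γ t)) (fun t => quadField (scale (κ * t) (a t))
      (scale (κ * t) (b t)) (scale (κ * t) (e t)) + (μ + κ) • X0) s := by
  have flow_add_smul (t : ℝ) (p p' : Sc × Sc) : flow t (p + μ • p') = flow t p + μ • flow t p' := by
    simp only [flow_apply, Prod.fst_add, Prod.snd_add, Prod.smul_fst, Prod.smul_snd, map_add,
      AlgHom.map_smul_of_tower, Prod.smul_mk, Prod.mk_add_mk]
  intro t ht
  refine (hasDerivWithinAt_flow (hγ t ht) κ).congr_deriv ?_
  simp only [Pi.add_apply, Pi.smul_apply, flow_add_smul, flow_quadField, flow_X0, add_smul,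
    add_assoc]

lemma locallyLipschitz_quadField_add_smul_X0 (a b e : Sc) (κ : ℝ) :
    LocallyLipschitz (quadField a b e + κ • X0) := by
  refine ContDiff.locallyLipschitz (𝕂 := ℝ) (contDiff_iff_contDiffAt.2 fun p => ?_)
  exact ((analyticOnNhd_quadField a b e p trivial).add
    (analyticOnNhd_X0 p trivial).const_smul).contDiffAt.restrict_scalars ℝ

/-- The field preserves `{Z = 0}`, and there it commutes with the conjugation of `W`. -/
lemma star_snd_eq_of_isIntegralCurveOn {a b e : Sc} (ha : star a = a) (he : star e = e) {κ : ℝ}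
    {γ : ℝ → Sc × Sc} {t₀ t₁ : ℝ} (h₀ : γ t₀ = 0)
    (hγ : IsIntegralCurveOn γ (fun _ => quadField a b e + κ • X0) (Set.Icc t₀ t₁)) {t : ℝ}
    (ht : t ∈ Set.Icc t₀ t₁) : star (γ t).2 = (γ t).2 := by
  have conj_curve : IsIntegralCurveOn (fun t => (0, star (γ t).2))
      (fun _ => quadField a b e + κ • X0) (Set.Icc t₀ t₁) := fun t ht => by
    have deriv_snd : HasDerivWithinAt (fun t => (γ t).2) _ (Set.Icc t₀ t₁) t := (hγ t ht).snd
    refine ((hasDerivWithinAt_const t _ (0 : Sc)).prodMk deriv_snd.star).congr_deriv ?_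
    ext1
    · simp [quadField, X0, mkSc]
    · simp only [quadField, X0, Pi.add_apply, Pi.smul_apply, Prod.snd_add, Prod.smul_snd, star_add,
        star_mul, star_pow, star_star, star_smul, star_trivial, star_mkSc, ha, he, star_ofNat,
        star_zero, snd_star]
      ring
  exact congrArg Prod.snd (eqOn_Icc_of_isIntegralCurveOn
    (locallyLipschitz_quadField_add_smul_X0 a b e κ) conj_curve hγ (by simp [h₀]) ht)

/-- Relative to `flow (κ * t)`, the field becomes `quadField` with coefficients depending on `t`. -/
lemma exists_isTimeOneMap_flow_comp_compMap {a b e : Sc} (ha : star a = a) (he : star e = e)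
    {κ : ℝ} {γ : ℝ → Sc × Sc} (h₀ : γ 0 = 0)
    (hγ : IsIntegralCurveOn γ (fun _ => quadField a b e + κ • X0) (Set.Icc 0 1)) :
    ∃ (A : S) (B : Sc) (C : S), IsUnit B ∧
      IsTimeOneMap (quadField a b e + κ • X0) (flow κ ∘ compMap (ofS A, B, ofS C)) := by
  have continuous_scale (x : Sc) : Continuous fun t => scale (-κ * t) x :=
    continuous_const.add (TrivSqZeroExt.continuous_inr.comp (by fun_prop))
  have riccati : IsIntegralCurveOn (fun t => (flow (-κ * t) (γ t)).2)
      (fun t w => scale (-κ * t) a + 2 * (scale (-κ * t) b + star (scale (-κ * t) b)) * w +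
        2 * scale (-κ * t) e * w ^ 2) (Set.Icc 0 1) := fun t ht => by
    have transported := isIntegralCurveOn_flow hγ (-κ) t ht
    simp only [add_neg_cancel, zero_smul, add_zero] at transported
    exact transported.snd
  have star_e (t : ℝ) : star (scale (-κ * t) e) = scale (-κ * t) e := by rw [star_scale, he]
  obtain ⟨q, q_zero, hq, q_fst, isUnit_star⟩ := exists_isIntegralCurveOn_paramField
    (continuous_scale b) (continuous_scale e) star_e zero_le_one riccati
  have star_q_fst (t : ℝ) (ht : t ∈ Set.Icc 0 1) : star (q t).1 = (q t).1 := by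
    rw [q_fst, flow_apply, star_scale, star_snd_eq_of_isIntegralCurveOn ha he h₀ hγ ht]
  obtain ⟨A, hA⟩ := exists_ofS_eq (star_q_fst 1 (Set.right_mem_Icc.2 zero_le_one))
  obtain ⟨C, hC⟩ := exists_ofS_eq (isUnit_star 1).2
  refine ⟨A, (q 1).2.1, C, (isUnit_star 1).1, ?_⟩
  filter_upwards [eventually_isIntegralCurveOn_compMap star_e isCompact_Icc hq star_q_fst]
    with p hp
  refine ⟨fun t => flow (κ * t) (compMap (q t) p), ?_, ?_, ?_⟩
  · simp [q_zero, flow_apply, h₀, compMap_zero_one_zero, scale_zero]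
  · simp [hA, hC]
  · have transported := isIntegralCurveOn_flow (μ := 0)
      (by simpa only [zero_smul, add_zero] using hp) κ
    simpa only [← scale_add, neg_mul, add_neg_cancel, scale_zero, zero_add] using transported

theorem IsExp.exists_eq_germ_flow_comp_compMap {a b e : Sc} (ha : star a = a) (he : star e = e)
    {κ : ℝ} {H : Germ (𝓝 (0 : Sc × Sc)) (Sc × Sc)}
    (h : IsExp (germ (quadField a b e) + κ • germ X0) H) :
    ∃ (A : S) (B : Sc) (C : S), IsUnit B ∧ H = germ (flow κ ∘ compMap (ofS A, B, ofS C)) := by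
  obtain ⟨h, rfl, isTimeOneMap_h⟩ := IsExp.exists_isTimeOneMap (f := quadField a b e + κ • X0)
    (fun p hp => (analyticOnNhd_quadField a b e p hp).add (analyticOnNhd_X0 p hp).const_smul) h
  obtain ⟨γ, γ_zero, -, hγ⟩ := isTimeOneMap_h.self_of_nhds
  obtain ⟨A, B, C, isUnit_B, isTimeOneMap_comp⟩ :=
    exists_isTimeOneMap_flow_comp_compMap ha he γ_zero hγ
  exact ⟨A, B, C, isUnit_B, Germ.coe_eq.2 <| isTimeOneMap_h.eventuallyEq
    (locallyLipschitz_quadField_add_smul_X0 a b e κ) isTimeOneMap_comp⟩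

/-- On `{W = 0}` the first component is `Z ↦ scale κ (B * Z)`, which is linear over `Sc` only for
`κ = 0`. -/
lemma eq_zero_of_sHol_flow_comp_compMap {κ : ℝ} {q : Sc × Sc × Sc} (hq : IsUnit q.2.1)
    (h : SHol (germ (flow κ ∘ compMap q))) : κ = 0 := by
  let Λ : Sc →ₗ[ℂ] Sc := (scale κ).toLinearMap ∘ₗ LinearMap.mulLeft ℂ q.2.1
  have Λ_eq_mul := ((sHol_germ_iff _).1 h).1.map_eq_mul (Λ := Λ) fun Z => by
    simp only [Function.comp_apply, compMap_apply_zero_right, flow_apply, Λ,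
      LinearMap.coe_comp, LinearMap.mulLeft_apply, AlgHom.toLinearMap_apply]
  have fst_ne_zero := isUnit_iff_fst_ne_zero.1 hq
  have Λ_eps := congrArg TrivSqZeroExt.snd (Λ_eq_mul (mkSc 0 1))
  have exp_eq_one : Complex.exp κ = 1 := by
    simpa [Λ, scale_apply, fst_ne_zero] using Λ_eps
  exact (Real.exp_eq_one_iff κ).1 (by exact_mod_cast exp_eq_one)

end Classification

section AutSLoc

lemma isTimeOneMap_compMap {a b e : Sc} (he : star e = e) {q : ℝ → Sc × Sc × Sc}
    (q_zero : q 0 = (0, 1, 0)) (hq : IsIntegralCurveOn q (fun _ => paramField a b e) (Set.Icc 0 1))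
    (hq₁ : ∀ t ∈ Set.Icc 0 1, star (q t).1 = (q t).1) :
    IsTimeOneMap (quadField a b e) (compMap (q 1)) := by
  filter_upwards [eventually_isIntegralCurveOn_compMap (fun _ => he) isCompact_Icc hq hq₁]
    with p hp
  exact ⟨fun t => compMap (q t) p, by simp only [q_zero, compMap_zero_one_zero], rfl, hp⟩

lemma germ_mem_AutSLoc {c : S × Sc × S} {A C : S} {B : Sc}
    (h : IsTimeOneMap (sField c) (compMap (ofS A, B, ofS C))) :
    germ (GNeg A ∘ GZero B ∘ GPos C) ∈ AutSLoc := by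
  rw [← germ_compMap_ofS]
  exact ⟨⟨_, sField_mem_aut c, h.isExp (analyticOnNhd_quadField _ _ _)⟩, sHol_compMap _⟩

lemma ofS_zero : ofS 0 = 0 := by ext <;> simp

lemma GNeg_zero : GNeg 0 = id := by
  funext p
  simp only [GNeg, ofS_zero, add_zero, id]

lemma GZero_one : GZero 1 = id := by
  funext p
  simp [GZero, ← star_eq_conjS]

lemma GPos_zero : GPos 0 = id := by
  funext p
  simp [GPos, ← invSqrt.eq_def, invSqrt_zero, ofS_zero]

lemma germ_GNeg_mem_AutSLoc (A : S) : germ (GNeg A) ∈ AutSLoc := by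
  have hq : IsIntegralCurveOn (fun t : ℝ => (t • ofS A, (1 : Sc), (0 : Sc)))
      (fun _ => paramField (ofS A) 0 0) (Set.Icc 0 1) := by
    refine isIntegralCurveOn_paramField (fun t _ => ?_)
      (fun t _ => (hasDerivWithinAt_const t _ _).congr_deriv (by simp))
      fun t _ => (hasDerivWithinAt_const t _ _).congr_deriv (by simp)
    exact ((hasDerivAt_id t).smul_const (ofS A)).hasDerivWithinAt.congr_deriv (by simp)
  have isTimeOneMap := isTimeOneMap_compMap (star_zero _) (by simp) hq (by simp [star_smul])
  simpa [GZero_one, GPos_zero] using germ_mem_AutSLoc (c := (A, 0, 0)) (A := A) (B := 1) (C := 0)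
    (by simpa [sField_apply, ofS_zero] using isTimeOneMap)

lemma germ_GPos_mem_AutSLoc (C : S) : germ (GPos C) ∈ AutSLoc := by
  have two_mul_half : 2 * ofS ((2⁻¹ : ℝ) • C) = ofS C := by ext <;> simp
  have hq : IsIntegralCurveOn (fun t : ℝ => ((0 : Sc), (1 : Sc), t • ofS C))
      (fun _ => paramField 0 0 (ofS ((2⁻¹ : ℝ) • C))) (Set.Icc 0 1) := by
    refine isIntegralCurveOn_paramField
      (fun t _ => (hasDerivWithinAt_const t _ _).congr_deriv (by simp))
      (fun t _ => (hasDerivWithinAt_const t _ _).congr_deriv (by simp)) fun t _ => ?_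
    exact ((hasDerivAt_id t).smul_const (ofS C)).hasDerivWithinAt.congr_deriv
      (by simp [two_mul_half])
  have isTimeOneMap := isTimeOneMap_compMap (star_ofS _) (by simp) hq (by simp)
  simpa [GZero_one, GNeg_zero] using germ_mem_AutSLoc (c := (0, 0, (2⁻¹ : ℝ) • C)) (A := 0)
    (B := 1) (C := C) (by simpa [sField_apply, ofS_zero] using isTimeOneMap)

lemma exists_exp_eq {B : Sc} (hB : IsUnit B) : ∃ β : Sc, NormedSpace.exp β = B := by
  have fst_ne_zero : B.fst ≠ 0 := isUnit_iff_fst_ne_zero.1 hB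
  refine ⟨mkSc (Complex.log B.fst) (B.snd / B.fst), ?_⟩
  have exp_log : NormedSpace.exp (Complex.log B.fst) = B.fst := by
    rw [← Complex.exp_eq_exp_ℂ, Complex.exp_log fst_ne_zero]
  rw [TrivSqZeroExt.exp_def]
  ext <;> simp [exp_log, mul_div_cancel₀, fst_ne_zero]

lemma germ_GZero_mem_AutSLoc {B : Sc} (hB : IsUnit B) : germ (GZero B) ∈ AutSLoc := by
  obtain ⟨β, rfl⟩ := exists_exp_eq hB
  have hq : IsIntegralCurveOn (fun t : ℝ => ((0 : Sc), NormedSpace.exp (t • β), (0 : Sc)))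
      (fun _ => paramField 0 β 0) (Set.Icc 0 1) := by
    refine isIntegralCurveOn_paramField
      (fun t _ => (hasDerivWithinAt_const t _ _).congr_deriv (by simp)) (fun t _ => ?_)
      fun t _ => (hasDerivWithinAt_const t _ _).congr_deriv (by simp)
    exact (hasDerivAt_exp_smul_const β t).hasDerivWithinAt.congr_deriv (by simp)
  have isTimeOneMap := isTimeOneMap_compMap (star_zero _) (by simp) hq (by simp)
  simpa [GNeg_zero, GPos_zero] using germ_mem_AutSLoc (c := (0, β, 0)) (A := 0)
    (B := NormedSpace.exp β) (C := 0) (by simpa [sField_apply, ofS_zero] using isTimeOneMap)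

lemma IsExp.exists_eq_germ_comp {c : S × Sc × S} {H : Germ (𝓝 (0 : Sc × Sc)) (Sc × Sc)}
    (h : IsExp (germ (sField c)) H) :
    ∃ (A : S) (B : Sc) (C : S), IsUnit B ∧ H = germ (GNeg A ∘ GZero B ∘ GPos C) := by
  obtain ⟨A, B, C, isUnit_B, rfl⟩ := IsExp.exists_eq_germ_flow_comp_compMap (κ := 0)
    (star_ofS c.1) (star_ofS c.2.2) (by rwa [zero_smul, add_zero])
  exact ⟨A, B, C, isUnit_B, by rw [flow_zero, Function.id_comp, germ_compMap_ofS]⟩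

lemma sHol_germ_comp (A : S) (B : Sc) (C : S) : SHol (germ (GNeg A ∘ GZero B ∘ GPos C)) :=
  germ_compMap_ofS A C B ▸ sHol_compMap _

lemma AutSLoc_eq : AutSLoc = {H | ∃ X ∈ autS, IsExp X H} := by
  ext H
  constructor
  · rintro ⟨⟨X, hX, h⟩, sHol_H⟩
    obtain ⟨c, κ, rfl⟩ := mem_aut_iff.1 hX
    obtain ⟨A, B, C, isUnit_B, rfl⟩ := h.exists_eq_germ_flow_comp_compMap
      (star_ofS c.1) (star_ofS c.2.2)
    obtain rfl := eq_zero_of_sHol_flow_comp_compMap isUnit_B sHol_H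
    exact ⟨_, sField_mem_autS c, by simpa only [zero_smul, add_zero] using h⟩
  · rintro ⟨X, hX, h⟩
    refine ⟨⟨X, hX.1, h⟩, ?_⟩
    obtain ⟨c, rfl⟩ := mem_autS_iff.1 hX
    obtain ⟨A, B, C, -, rfl⟩ := h.exists_eq_germ_comp
    exact sHol_germ_comp A B C

lemma mem_AutSLoc_iff {H : Germ (𝓝 (0 : Sc × Sc)) (Sc × Sc)} (hH : H ∈ AutLoc rho) :
    H ∈ AutSLoc ↔ ∃ (A : S) (B : Sc) (C : S), IsUnit B ∧
      H = germ (GNeg A ∘ GZero B ∘ GPos C) := by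
  constructor
  · intro h
    rw [AutSLoc_eq] at h
    obtain ⟨X, hX, h⟩ := h
    obtain ⟨c, rfl⟩ := mem_autS_iff.1 hX
    exact h.exists_eq_germ_comp
  · rintro ⟨A, B, C, -, rfl⟩
    exact ⟨hH, sHol_germ_comp A B C⟩

end AutSLoc

end AlgCR

end

theorem mainTheorem3 :
    -- the surface in coordinates of `ℂ⁴`
    (∀ z₁ z₂ w₁ w₂ : ℂ, (AlgCR.mkSc z₁ z₂, AlgCR.mkSc w₁ w₂) ∈ AlgCR.Q ↔
      w₁.im = ‖z₁‖ ^ 4 ∧ w₂.im = 4 * (z₁ ^ 2 * star z₁ * star z₂).re) ∧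
    -- `aut Q` is `aut_S Q` plus the line spanned by the additional field
    FiniteDimensional ℝ (AlgCR.aut AlgCR.rho) ∧
    Module.finrank ℝ (AlgCR.aut AlgCR.rho) = Module.finrank ℝ AlgCR.autS + 1 ∧
    AlgCR.autS ⊔ Submodule.span ℝ {AlgCR.germ AlgCR.X0} = AlgCR.aut AlgCR.rho ∧
    AlgCR.autS ⊓ Submodule.span ℝ {AlgCR.germ AlgCR.X0} = ⊥ ∧
    -- the one-parameter group of the additional field
    (∀ t : ℝ, AlgCR.IsExp (t • AlgCR.germ AlgCR.X0) (AlgCR.germ (AlgCR.flow t))) ∧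
    (∀ p : AlgCR.Sc × AlgCR.Sc, ∀ t : ℝ,
      HasDerivAt (fun s => AlgCR.flow s p) (AlgCR.X0 (AlgCR.flow t p)) t) ∧
    AlgCR.flow 0 = id ∧
    (∀ s t : ℝ, AlgCR.flow (s + t) = AlgCR.flow s ∘ AlgCR.flow t) ∧
    (∀ t : ℝ, Differentiable ℂ (AlgCR.flow t) ∧ AlgCR.flow t '' AlgCR.Q = AlgCR.Q) ∧
    -- the `S`-holomorphic part of the local group
    AlgCR.AutSLoc = {H | ∃ X ∈ AlgCR.autS, AlgCR.IsExp X H} ∧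
    (∀ A : AlgCR.S, AlgCR.germ (AlgCR.GNeg A) ∈ AlgCR.AutSLoc) ∧
    (∀ B : AlgCR.Sc, IsUnit B → AlgCR.germ (AlgCR.GZero B) ∈ AlgCR.AutSLoc) ∧
    (∀ C : AlgCR.S, AlgCR.germ (AlgCR.GPos C) ∈ AlgCR.AutSLoc) ∧
    (∀ H ∈ AlgCR.AutLoc AlgCR.rho, H ∈ AlgCR.AutSLoc ↔
      ∃ (A : AlgCR.S) (B : AlgCR.Sc) (C : AlgCR.S), IsUnit B ∧
        H = AlgCR.germ (AlgCR.GNeg A ∘ AlgCR.GZero B ∘ AlgCR.GPos C)) := by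
  exact ⟨AlgCR.mkSc_mem_Q_iff, AlgCR.finiteDimensional_aut, AlgCR.finrank_aut,
    AlgCR.autS_sup_span_X0, AlgCR.autS_inf_span_X0, AlgCR.isExp_flow, AlgCR.hasDerivAt_flow,
    AlgCR.flow_zero, AlgCR.flow_add,
    fun t => ⟨AlgCR.differentiable_flow t, AlgCR.flow_image_Q t⟩, AlgCR.AutSLoc_eq,
    AlgCR.germ_GNeg_mem_AutSLoc, fun _ => AlgCR.germ_GZero_mem_AutSLoc,
    AlgCR.germ_GPos_mem_AutSLoc, fun _ => AlgCR.mem_AutSLoc_iff⟩
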